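/- **Setting.** Let $\varepsilon,\delta\in(0,1)$ and $C>0$. For $\ell\ge 1$ put $s_\ell=\Big\lceil \frac{2}{(\varepsilon/200)^2}\ln\!\big(\tfrac4\delta\big)\,3^\ell\Big\rceil$ and $b=\Big\lceil \frac{2}{(\varepsilon/200)^2}\,C\ln\!\big(\tfrac4\delta\big)+s_1\Big\rceil$. Each arm has a reward law on $[0,1]$; pulling the arm gives an independent sample of it, and the mean of the arm is the mean of its law. The following streaming algorithm stores one arm (the *king*) besides the arriving one. The first arm becomes king with budget $\phi=0$. When a new arm $a$ arrives, $\phi$ is increased by $b$; then, for $\ell=1,2,\dots$: if $\phi<s_\ell$, the king is defeated, $a$ becomes king with budget $\phi=0$, and the next arm is awaited; otherwise $\phi$ is decreased by $s_\ell$, the king and $a$ are both pulled $s_\ell$ fresh times, and if their empirical means in this trial satisfy $\widehat\mu_{\rm king}>\widehat\mu_a-0.495\,\varepsilon$, the king wins and the next arm is awaited, otherwise the level $\ell+1$ follows. When the stream ends the king is returned. An arm is $\varepsilon$-best among $n$ arms if its mean is at least the maximum of the $n$ means minus $\varepsilon$. **Theorem.** There is an absolute constant $C_0$ such that for every $C\ge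 C_0$ the following holds. Let $\mathcal D$ be one of these distributions on $(0,1]$, with arbitrary parameters: the uniform distribution on $(0,1]$; a normal, lognormal, exponential, gamma or Weibull distribution truncated to $(0,1]$ (i.e. conditioned on $(0,1]$); a beta distribution. Let $0<\varepsilon\le 1/10$ and $0<\delta<1$. Let arms $a_1,a_2,\dots$ be drawn independently from a population of arms (that is, from any probability distribution on arms with reward laws on $[0,1]$, depending measurably on the arm) in which the mean of a random arm has distribution $\mathcal D$. For given $a_1,\dots,a_n$ let $p_n(a_1,\dots,a_n)$ be the probability that the algorithm returns an $\varepsilon$-best arm of $a_1,\dots,a_n$ when these arms arrive in uniformly random order, the probability being over the order and the rewards. Then 1. almost surely with respect to the drawn arms, $p_n(a_1,\dots,a_n)\ge 0.9\,(1-\delta)$ for all sufficiently large $n$; 2. $\mathbb E\big[p_n(a_1,\dots,a_n)\big]\ge 0.9\,(1-\delta)$ for all sufficiently large $n$, i.e. the same bound holds for the overall probability of success, taken over the drawn arms, the arrival order and the rewards. -/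

import Mathlib

open MeasureTheory ProbabilityTheory Filter

noncomputable section

namespace StreamingBandit

/-! ### The algorithm -/

/-- Empirical mean of `s` observed rewards. -/
def empMean {s : ℕ} (x : Fin s → ℝ) : ℝ := (∑ j, x j) / s

/-- The number `s_ℓ` of pulls of the king and of the challenger at level `ℓ`. -/
def sampleSize (ε δ : ℝ) (ℓ : ℕ) : ℕ :=
  ⌈2 / (ε / 200) ^ 2 * Real.log (4 / δ) * 3 ^ ℓ⌉₊

/-- The amount `b` added to the budget of the king whenever a new arm arrives. -/
def budgetStep (C ε δ : ℝ) : ℕ :=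
  ⌈2 / (ε / 200) ^ 2 * C * Real.log (4 / δ) + sampleSize ε δ 1⌉₊

/-- The king wins a trial if `x` (rewards of the king) and `y` (rewards of the challenger)
satisfy `mean x > mean y - 0.495 ε`. -/
def kingWins (ε : ℝ) {s : ℕ} (x y : Fin s → ℝ) : Prop :=
  empMean x > empMean y - 0.495 * ε

open Classical in
/-- The outcome of a trial as a function of all the rewards observed in it. -/
def trialOutcome (ε : ℝ) {s : ℕ} (r : (Fin s → ℝ) × (Fin s → ℝ)) : Bool :=
  decide (kingWins ε r.1 r.2)

lemma measurable_trialOutcome (ε : ℝ) (s : ℕ) :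
    Measurable (trialOutcome ε : (Fin s → ℝ) × (Fin s → ℝ) → Bool) := by
  have h : MeasurableSet {r : (Fin s → ℝ) × (Fin s → ℝ) | kingWins ε r.1 r.2} := by
    unfold kingWins empMean
    apply measurableSet_lt <;> fun_prop
  refine measurable_to_bool ?_
  convert h using 1
  ext r
  simp [trialOutcome]

instance isProbabilityMeasure_trial (ε : ℝ) (s : ℕ) (P P' : Measure ℝ)
    [IsProbabilityMeasure P] [IsProbabilityMeasure P'] :
    IsProbabilityMeasure (((Measure.pi fun _ : Fin s => P).prod
      (Measure.pi fun _ : Fin s => P')).map (trialOutcome ε)) :=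
  Measure.isProbabilityMeasure_map (measurable_trialOutcome ε s).aemeasurable

/-- One trial: `s` fresh independent pulls of the king (reward law `P`) and `s` fresh
independent pulls of the challenger (reward law `P'`). The result is `true` if the king wins. -/
def trial (ε : ℝ) (s : ℕ) (P P' : Measure ℝ)
    [IsProbabilityMeasure P] [IsProbabilityMeasure P'] : PMF Bool :=
  (((Measure.pi fun _ : Fin s => P).prod
    (Measure.pi fun _ : Fin s => P')).map (trialOutcome ε)).toPMF

/-- The challenge subroutine from level `ℓ` on, when the king has budget `φ`. The result is `none`
if the king is defeated and `some φ'` if the king wins and is left with budget `φ'`.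
(The test `0 < s_ℓ` always succeeds for `0 < δ < 1` and `0 < ε`; it makes it evident
that the loop terminates.) -/
def challenge (ε δ : ℝ) (P P' : Measure ℝ)
    [IsProbabilityMeasure P] [IsProbabilityMeasure P'] (ℓ φ : ℕ) : PMF (Option ℕ) :=
  if _h : 0 < sampleSize ε δ ℓ ∧ sampleSize ε δ ℓ ≤ φ then
    (trial ε (sampleSize ε δ ℓ) P P').bind fun win =>
      if win then PMF.pure (some (φ - sampleSize ε δ ℓ))
      else challenge ε δ P P' (ℓ + 1) (φ - sampleSize ε δ ℓ)
  else PMF.pure none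
termination_by φ
decreasing_by omega

/-- Processing of a newly arrived arm `i`. The state consists of the king and its budget. -/
def processArm (C ε δ : ℝ) {ι : Type*} (law : ι → Measure ℝ)
    [∀ i, IsProbabilityMeasure (law i)] (state : ι × ℕ) (i : ι) : PMF (ι × ℕ) :=
  (challenge ε δ (law state.1) (law i) 1 (state.2 + budgetStep C ε δ)).map fun result =>
    match result with
    | some φ => (state.1, φ)
    | none => (i, 0)

/-- Processing of a stream of arms, in the order of the list. -/
def processStream (C ε δ : ℝ) {ι : Type*} (law : ι → Measure ℝ)
    [∀ i, IsProbabilityMeasure (law i)] : List ι → ι × ℕ → PMF (ι × ℕ)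
  | [], state => PMF.pure state
  | i :: stream, state =>
      (processArm C ε δ law state i).bind (processStream C ε δ law stream)

/-- The algorithm: the first arm becomes the king with budget `0`, the remaining stream is
processed, and the final king is returned (`none` is returned only on the empty stream). -/
def algorithm (C ε δ : ℝ) {ι : Type*} (law : ι → Measure ℝ)
    [∀ i, IsProbabilityMeasure (law i)] : List ι → PMF (Option ι)
  | [] => PMF.pure none
  | i :: stream => (processStream C ε δ law stream (i, 0)).map fun state => some state.1

/-- Random order arrival of `n` arms: the arms arrive in the order `σ 0, σ 1, …, σ (n - 1)`
for a uniformly random permutation `σ`, and the algorithm is run on this stream. -/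
def algorithmRandomOrder (C ε δ : ℝ) {n : ℕ} (law : Fin n → Measure ℝ)
    [∀ i, IsProbabilityMeasure (law i)] : PMF (Option (Fin n)) :=
  (PMF.uniformOfFintype (Equiv.Perm (Fin n))).bind fun σ =>
    algorithm C ε δ law (List.ofFn σ)

/-! ### The guarantee -/

/-- Mean reward of an arm with reward law `P`. -/
def meanReward (P : Measure ℝ) : ℝ := ∫ x, x ∂P

/-- Arm `i` is an `ε`-best arm: its mean is at least the largest mean minus `ε`. -/
def IsEpsBest {n : ℕ} (law : Fin n → Measure ℝ) (ε : ℝ) (i : Fin n) : Prop :=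
  (⨆ j, meanReward (law j)) - ε ≤ meanReward (law i)

/-- The probability, over the arrival order and the rewards, that the algorithm returns an
`ε`-best arm of the given `n` arms. -/
def successProb (C ε δ : ℝ) {n : ℕ} (law : Fin n → Measure ℝ)
    [∀ i, IsProbabilityMeasure (law i)] : ℝ :=
  ((algorithmRandomOrder C ε δ law).toOuterMeasure
    {o | ∃ i, o = some i ∧ IsEpsBest law ε i}).toReal

/-! ### The distributions of the means -/

/-- The distribution `D` truncated to `(0, 1]`. -/
def truncate (D : Measure ℝ) : Measure ℝ := ProbabilityTheory.cond D (Set.Ioc 0 1)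

/-- The Weibull distribution with shape `k` and scale `l`. -/
def weibullMeasure (k l : ℝ) : Measure ℝ :=
  volume.withDensity fun x =>
    ENNReal.ofReal (if 0 ≤ x then k / l * (x / l) ^ (k - 1) * Real.exp (-(x / l) ^ k) else 0)

/-- The lognormal distribution: the law of `exp Z` for `Z` normal with mean `m`, variance `v`. -/
def lognormalMeasure (m : ℝ) (v : NNReal) : Measure ℝ := (gaussianReal m v).map Real.exp

/-- The distributions on `(0, 1]` considered for the means of the arms. -/
inductive IsMeanDistribution : Measure ℝ → Prop
  | uniform : IsMeanDistribution (volume.restrict (Set.Ioc 0 1))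
  | normal (m : ℝ) (v : NNReal) (hv : v ≠ 0) :
      IsMeanDistribution (truncate (gaussianReal m v))
  | lognormal (m : ℝ) (v : NNReal) (hv : v ≠ 0) :
      IsMeanDistribution (truncate (lognormalMeasure m v))
  | exponential (r : ℝ) (hr : 0 < r) : IsMeanDistribution (truncate (expMeasure r))
  | beta (p q : ℝ) (hp : 0 < p) (hq : 0 < q) : IsMeanDistribution (betaMeasure p q)
  | gamma (k r : ℝ) (hk : 0 < k) (hr : 0 < r) :
      IsMeanDistribution (truncate (gammaMeasure k r))
  | weibull (k l : ℝ) (hk : 0 < k) (hl : 0 < l) :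
      IsMeanDistribution (truncate (weibullMeasure k l))

end StreamingBandit

end

/-! All means are at most 1, and every admissible law of the means charges each neighbourhood of 1
(`IsMeanDistribution.measure_Ici_pos`); nothing else about the law is used. An arm of mean at least
1 - ε is therefore ε-best whatever the other arms are, and it suffices to bound the probability that
a king of mean below 1 - ε reigns at some time from a fixed `N` on.

Consider first an i.i.d. stream. During one reign the budget is a random walk whose step is
determined by the level at which the king wins. A challenger at most 0.49 ε better dethrones the
king with probability exponentially small in the budget (`defeatProb_le`), so this cost has to be
summed along the walk. Nothing is known about the drift. Instead, time reversal turns survival of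
the walk into the event that its endpoint is a record, and the expected number of records in a
window as long as one of the steps is at most the inverse probability of that step
(`recordCount_le`, `killedCost_zero_le`). The step used is a win at level 1; its probability is at
least half the probability that a random arm is no better than the king. A challenger more than 0.49
ε better may take over, but a chain of such upgrades starting at mean 1 - ε or more involves at most
three reigns (`meanLeaveProb_le_of_rank`).

Two cases remain (`exists_lintegral_meanLeaveProb_le`). If a random arm has mean at most 1 - ε with
probability at least 1/50, every good king has many weaker opponents, and a bad king is soon
dethroned by an arm of mean at least 1 - ε/2 (`meanLeaveProb_le_of_lt`). Otherwise the first king is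
already good and not of low rank, except with probability 1/50. In both cases the probability of a
late bad king is at most 3/100.

For random arrival of fixed arms, the failure probability is at most the average, over permutations
of the first n terms, of one function of the infinite sequence that does not depend on n
(`one_sub_successProb_le`). Such averages form a reverse martingale. The maximal inequality
`maximal_permAvg` and an L² bound for functions of finitely many terms show that they are almost
surely eventually at most 1/10 (`ae_eventually_permAvg_le`). Averaging preserves integrals, which
gives the statement in expectation. The success bound obtained is 0.9 itself; δ matters only through
the sample sizes. -/

noncomputable section

namespace StreamingBandit

open scoped ENNReal

/-! ### A ballot-type bound for random walks -/

section Walk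

variable {ι : Type*}

/-- Sum of `F` over the words of length `t`, weighted by the product of the weights of their
letters. -/
def pathSum (ν : ι → ℝ≥0∞) : ℕ → (List ι → ℝ≥0∞) → ℝ≥0∞
  | 0, F => F []
  | t + 1, F => ∑' j, ν j * pathSum ν t (fun l => F (j :: l))

lemma pathSum_snoc (ν : ι → ℝ≥0∞) (t : ℕ) (F : List ι → ℝ≥0∞) :
    pathSum ν (t + 1) F = ∑' j, ν j * pathSum ν t (fun l => F (l ++ [j])) := by
  induction t generalizing F with
  | zero => simp [pathSum]
  | succ t ih =>
    rw [pathSum]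
    conv_lhs => simp only [ih]
    simp only [pathSum, List.cons_append, ← ENNReal.tsum_mul_left]
    rw [ENNReal.tsum_comm]
    exact tsum_congr fun i => tsum_congr fun j => by ring

/-- The weight of a word does not depend on the order of its letters, so the walk may be reversed in
time. -/
lemma pathSum_reverse (ν : ι → ℝ≥0∞) (t : ℕ) (F : List ι → ℝ≥0∞) :
    pathSum ν t (fun l => F l.reverse) = pathSum ν t F := by
  induction t generalizing F with
  | zero => simp [pathSum]
  | succ t ih =>
    rw [pathSum_snoc ν t F, pathSum]
    refine tsum_congr fun j => ?_
    rw [← ih]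
    simp

lemma pathSum_congr (ν : ι → ℝ≥0∞) (t : ℕ) {F G : List ι → ℝ≥0∞} (h : ∀ l, F l = G l) :
    pathSum ν t F = pathSum ν t G := by
  rw [funext h]

lemma pathSum_mono (ν : ι → ℝ≥0∞) (t : ℕ) {F G : List ι → ℝ≥0∞} (h : ∀ l, F l ≤ G l) :
    pathSum ν t F ≤ pathSum ν t G := by
  induction t generalizing F G with
  | zero => exact h []
  | succ t ih =>
    exact ENNReal.tsum_le_tsum fun j => mul_le_mul_right (ih fun l => h (j :: l)) _

lemma pathSum_const_mul (ν : ι → ℝ≥0∞) (t : ℕ) (c : ℝ≥0∞) (F : List ι → ℝ≥0∞) :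
    pathSum ν t (fun l => c * F l) = c * pathSum ν t F := by
  induction t generalizing F with
  | zero => rfl
  | succ t ih =>
    simp only [pathSum, ih, ← ENNReal.tsum_mul_left]
    exact tsum_congr fun j => by ring

lemma pathSum_tsum (ν : ι → ℝ≥0∞) (t : ℕ) {α : Type*} (F : α → List ι → ℝ≥0∞) :
    pathSum ν t (fun l => ∑' k, F k l) = ∑' k, pathSum ν t (F k) := by
  induction t generalizing F with
  | zero => rfl
  | succ t ih =>
    simp only [pathSum, ih, ← ENNReal.tsum_mul_left]
    rw [ENNReal.tsum_comm]

/-- The walk with steps `x j`, started at `y`, stays nonnegative along the word. -/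
def Alive (x : ι → ℤ) : ℤ → List ι → Prop
  | _, [] => True
  | y, j :: l => 0 ≤ y + x j ∧ Alive x (y + x j) l

/-- Distance of the walk to its running maximum after reading a word, when it is `d` initially. -/
def gap (x : ι → ℤ) : ℤ → List ι → ℤ
  | d, [] => d
  | d, j :: l => gap x (max (d - x j) 0) l

/-- Displacement of the walk along a word. -/
def disp (x : ι → ℤ) (l : List ι) : ℤ := (l.map x).sum

lemma gap_snoc (x : ι → ℤ) (d : ℤ) (l : List ι) (j : ι) :
    gap x d (l ++ [j]) = max (gap x d l - x j) 0 := by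
  induction l generalizing d with
  | nil => rfl
  | cons i l ih => exact ih _

lemma gap_nonneg (x : ι → ℤ) {d : ℤ} (hd : 0 ≤ d) (l : List ι) : 0 ≤ gap x d l := by
  induction l generalizing d with
  | nil => exact hd
  | cons i l ih => exact ih (le_max_right _ _)

/-- The partial sums of the reversed word are the suffix sums of `l`, and the distance to the
running maximum is the largest negated suffix sum, the empty suffix included. The latter is why `y`
must be nonnegative. -/
lemma alive_reverse_iff (x : ι → ℤ) (l : List ι) {y : ℤ} (hy : 0 ≤ y) :
    Alive x y l.reverse ↔ gap x 0 l ≤ y := by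
  induction l using List.reverseRecOn generalizing y with
  | nil => simpa [Alive, gap] using hy
  | append_singleton l j ih =>
    rw [List.reverse_append, gap_snoc]
    simp only [List.reverse_cons, List.reverse_nil, List.nil_append, List.cons_append, Alive]
    have h0 := gap_nonneg x le_rfl l
    constructor
    · rintro ⟨h1, h2⟩
      rw [ih h1] at h2
      exact max_le (by linarith) hy
    · intro h
      have h1 : gap x 0 l - x j ≤ y := (le_max_left _ _).trans h
      have h2 : 0 ≤ y + x j := by linarith
      exact ⟨h2, (ih h2).2 (by linarith)⟩

open Classical in
/-- Expected number of times before `T` at which the walk started at `y`, at distance `d` below its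
running maximum, is at its running maximum and in `I`. -/
def recordCount (ν : ι → ℝ≥0∞) (x : ι → ℤ) (I : Set ℤ) (T : ℕ) (y d : ℤ) : ℝ≥0∞ :=
  ∑ t ∈ Finset.range T,
    pathSum ν t fun l => if gap x d l = 0 ∧ y + disp x l ∈ I then 1 else 0

open Classical in
lemma recordCount_succ (ν : ι → ℝ≥0∞) (x : ι → ℤ) (I : Set ℤ) (T : ℕ) (y d : ℤ) :
    recordCount ν x I (T + 1) y d =
      (∑' j, ν j * recordCount ν x I T (y + x j) (max (d - x j) 0)) +
        if d = 0 ∧ y ∈ I then 1 else 0 := by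
  unfold recordCount
  rw [Finset.sum_range_succ']
  congr 1
  · simp only [pathSum, Finset.mul_sum]
    rw [Summable.tsum_finsetSum fun _ _ => ENNReal.summable]
    simp only [gap, disp, List.map_cons, List.sum_cons, add_assoc]
  · simp [pathSum, gap, disp]

/-- The running maximum is `y + d`; once it has reached `a`, every later record lies beyond `I`. -/
lemma recordCount_eq_zero (ν : ι → ℝ≥0∞) (x : ι → ℤ) (a : ℤ) {I : Set ℤ} (hI : ∀ z ∈ I, z < a)
    (T : ℕ) {y d : ℤ} (h : a ≤ y + d) : recordCount ν x I T y d = 0 := by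
  induction T generalizing y d with
  | zero => simp [recordCount]
  | succ T ih =>
    rw [recordCount_succ, if_neg, add_zero]
    · refine ENNReal.tsum_eq_zero.2 fun j => ?_
      rw [ih, mul_zero]
      have := le_max_left (d - x j) 0
      linarith
    · rintro ⟨rfl, hy⟩
      have := hI y hy
      linarith

/-- From a record in the window the step `i` jumps past its upper end, after which no record falls
in the window again. Each counted record is thus the last one with probability at least `ν i`, and
the count is dominated by a geometric variable. -/
lemma recordCount_le (ν : ι → ℝ≥0∞) (hν : ∑' j, ν j ≤ 1) (x : ι → ℤ) (i : ι) (a : ℤ) (T : ℕ)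
    (y d : ℤ) : recordCount ν x (Set.Ico a (a + x i)) T y d ≤ (ν i)⁻¹ := by
  classical
  rcases eq_or_ne (ν i) 0 with h0 | h0
  · simp [h0]
  have hsplit : ν i + ∑' j, (if j = i then 0 else ν j) ≤ 1 := by
    rwa [← ENNReal.tsum_eq_add_tsum_ite]
  have hi1 : ν i ≤ 1 := le_self_add.trans hsplit
  have hit : ν i ≠ ∞ := ne_top_of_le_ne_top ENNReal.one_ne_top hi1
  have hinv : 1 ≤ (ν i)⁻¹ := ENNReal.one_le_inv.2 hi1
  induction T generalizing y d with
  | zero => simp [recordCount]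
  | succ T ih =>
    rw [recordCount_succ]
    split_ifs with h
    · obtain ⟨rfl, hy⟩ := h
      rw [ENNReal.tsum_eq_add_tsum_ite i, recordCount_eq_zero ν x (a + x i) (fun z hz => hz.2),
        mul_zero, zero_add]
      · calc (∑' j, if j = i then 0 else
              ν j * recordCount ν x (Set.Ico a (a + x i)) T (y + x j) (max (0 - x j) 0)) + 1
            ≤ (∑' j, (if j = i then 0 else ν j) * (ν i)⁻¹) + ν i * (ν i)⁻¹ := by
              rw [ENNReal.mul_inv_cancel h0 hit]
              gcongr with j
              split_ifs
              · simp
              · exact mul_le_mul_right (ih _ _) _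
          _ = (ν i + ∑' j, (if j = i then 0 else ν j)) * (ν i)⁻¹ := by
              rw [ENNReal.tsum_mul_right]; ring
          _ ≤ 1 * (ν i)⁻¹ := by gcongr
          _ = _ := one_mul _
      · have := hy.1
        have := le_max_right (0 - x i) 0
        linarith
    · rw [add_zero]
      calc _ ≤ ∑' j, ν j * (ν i)⁻¹ := ENNReal.tsum_le_tsum fun j => mul_le_mul_right (ih _ _) _
        _ ≤ 1 * (ν i)⁻¹ := by rw [ENNReal.tsum_mul_right]; gcongr
        _ = _ := one_mul _

open Classical in
/-- Expected total cost before time `T` of the walk started at `y` and killed when it becomes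
negative, if `β z` is charged at `z`. -/
def killedCost (ν : ι → ℝ≥0∞) (x : ι → ℤ) (β : ℤ → ℝ≥0∞) : ℕ → ℤ → ℝ≥0∞
  | 0, _ => 0
  | T + 1, y => (∑' j, ν j * if 0 ≤ y + x j then killedCost ν x β T (y + x j) else 0) + β y

open Classical in
lemma killedCost_eq (ν : ι → ℝ≥0∞) (x : ι → ℤ) (β : ℤ → ℝ≥0∞) (T : ℕ) (y : ℤ) :
    killedCost ν x β T y = ∑ t ∈ Finset.range T,
      pathSum ν t fun l => if Alive x y l then β (y + disp x l) else 0 := by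
  induction T generalizing y with
  | zero => simp [killedCost]
  | succ T ih =>
    rw [Finset.sum_range_succ', killedCost]
    congr 1
    · simp only [pathSum]
      rw [← Summable.tsum_finsetSum fun _ _ => ENNReal.summable]
      refine tsum_congr fun j => ?_
      rw [← Finset.mul_sum]
      congr 1
      split_ifs with h
      · rw [ih]
        simp [Alive, h, disp, add_assoc]
      · rw [eq_comm]
        refine Finset.sum_eq_zero fun t _ => ?_
        simp only [Alive, h, false_and, if_false]
        simpa using pathSum_const_mul ν t 0 (fun _ => 0)
    · simp [pathSum, Alive, disp]

/-- A bound for the cost of a killed walk by its cost on a single arithmetic progression, whose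
common difference is one of the steps. -/
theorem killedCost_zero_le (ν : ι → ℝ≥0∞) (hν : ∑' j, ν j ≤ 1) (x : ι → ℤ) (i : ι) (hi : 0 < x i)
    (β : ℤ → ℝ≥0∞) (hβ : Antitone β) (T : ℕ) :
    killedCost ν x β T 0 ≤ (ν i)⁻¹ * ∑' k : ℕ, β (k * x i) := by
  classical
  -- Expected number of surviving visits to one window: after reversing the words these are the
  -- visits at records.
  have key : ∀ k : ℕ, ∑ t ∈ Finset.range T, pathSum ν t (fun l =>
      if Alive x 0 l ∧ disp x l ∈ Set.Ico (k * x i) (k * x i + x i) then 1 else 0) ≤ (ν i)⁻¹ := by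
    intro k
    refine le_trans (le_of_eq ?_) (recordCount_le ν hν x i (k * x i) T 0 0)
    refine Finset.sum_congr rfl fun t _ => ?_
    rw [← pathSum_reverse]
    refine pathSum_congr ν t fun l => ?_
    have h1 : disp x l.reverse = disp x l := by simp [disp, List.sum_reverse]
    have h2 : gap x 0 l ≤ 0 ↔ gap x 0 l = 0 :=
      ⟨fun h => le_antisymm h (gap_nonneg x le_rfl l), fun h => h.le⟩
    rw [h1, alive_reverse_iff x l le_rfl, h2, zero_add]
    congr
  have hpos : ∀ (y : ℤ) (l : List ι), 0 ≤ y → Alive x y l → 0 ≤ y + disp x l := by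
    intro y l
    induction l generalizing y with
    | nil => intro hy _; simpa [disp] using hy
    | cons j l ih =>
      rintro hy ⟨h1, h2⟩
      have := ih _ h1 h2
      simpa [disp, add_assoc] using this
  -- The half-line is cut into windows of length `x i`; on each of them `β` is at most its value at
  -- the left end.
  rw [killedCost_eq]
  calc ∑ t ∈ Finset.range T, pathSum ν t (fun l => if Alive x 0 l then β (0 + disp x l) else 0)
      ≤ ∑ t ∈ Finset.range T, pathSum ν t (fun l => ∑' k : ℕ, β (k * x i) *
          if Alive x 0 l ∧ disp x l ∈ Set.Ico (k * x i) (k * x i + x i) then 1 else 0) := by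
        refine Finset.sum_le_sum fun t _ => pathSum_mono ν t fun l => ?_
        split_ifs with h
        · have h0 := hpos 0 l le_rfl h
          rw [zero_add] at h0 ⊢
          have hq : 0 ≤ disp x l / x i := Int.ediv_nonneg h0 hi.le
          have hq' : ((disp x l / x i).toNat : ℤ) = disp x l / x i := Int.toNat_of_nonneg hq
          have hm := Int.emod_nonneg (disp x l) hi.ne'
          have hm' := Int.emod_lt_of_pos (disp x l) hi
          have hd := Int.mul_ediv_add_emod (disp x l) (x i)
          have hmem : disp x l ∈ Set.Ico (((disp x l / x i).toNat : ℤ) * x i)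
              (((disp x l / x i).toNat : ℤ) * x i + x i) := by
            rw [hq', mul_comm]
            constructor <;> linarith
          refine le_trans ?_ (ENNReal.le_tsum (disp x l / x i).toNat)
          rw [if_pos ⟨h, hmem⟩, mul_one]
          exact hβ hmem.1
        · exact zero_le
    _ = ∑' k : ℕ, β (k * x i) * ∑ t ∈ Finset.range T, pathSum ν t (fun l =>
          if Alive x 0 l ∧ disp x l ∈ Set.Ico (k * x i) (k * x i + x i) then 1 else 0) := by
        simp only [pathSum_tsum, pathSum_const_mul, Finset.mul_sum]
        rw [Summable.tsum_finsetSum fun _ _ => ENNReal.summable]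
    _ ≤ ∑' k : ℕ, β (k * x i) * (ν i)⁻¹ :=
        ENNReal.tsum_le_tsum fun k => mul_le_mul_right (key k) _
    _ = _ := by rw [ENNReal.tsum_mul_right, mul_comm]

end Walk

/-! ### A single trial -/

section Trial

/-- **Hoeffding's inequality** for the upper deviation of the empirical mean. -/
lemma measureReal_empMean_ge_le (P : Measure ℝ) [IsProbabilityMeasure P]
    (hP : P (Set.Icc 0 1) = 1) {s : ℕ} (hs : 0 < s) {t : ℝ} (ht : 0 ≤ t) :
    (Measure.pi fun _ : Fin s => P).real {x | meanReward P + t ≤ empMean x} ≤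
      Real.exp (-2 * s * t ^ 2) := by
  have hb : ∀ᵐ y ∂P, y ∈ Set.Icc (0 : ℝ) 1 :=
    (mem_ae_iff_prob_eq_one measurableSet_Icc).2 hP
  have h1 : HasSubgaussianMGF (fun y : ℝ => y - meanReward P) ((‖(1 : ℝ) - 0‖₊ / 2) ^ 2) P :=
    hasSubgaussianMGF_of_mem_Icc (X := fun y : ℝ => y) aemeasurable_id hb
  have hind : iIndepFun (fun (i : Fin s) (x : Fin s → ℝ) => x i - meanReward P)
      (Measure.pi fun _ : Fin s => P) :=
    iIndepFun_pi (X := fun _ (y : ℝ) => y - meanReward P) fun _ => by fun_prop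
  have hsub : ∀ i ∈ (Finset.univ : Finset (Fin s)),
      HasSubgaussianMGF (fun x : Fin s → ℝ => x i - meanReward P)
        ((fun _ => (‖(1 : ℝ) - 0‖₊ / 2) ^ 2) i) (Measure.pi fun _ : Fin s => P) := by
    intro i _
    have hmp := measurePreserving_eval (fun _ : Fin s => P) i
    refine HasSubgaussianMGF.of_map (Y := fun x : Fin s → ℝ => x i)
      (X := fun y : ℝ => y - meanReward P)
      (measurable_pi_apply i).aemeasurable ?_
    rw [show Measure.map (fun x : Fin s → ℝ => x i) (Measure.pi fun _ : Fin s => P) = P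
      from hmp.map_eq]
    exact h1
  have hs' : (0 : ℝ) < s := by exact_mod_cast hs
  have key := HasSubgaussianMGF.measure_sum_ge_le_of_iIndepFun hind hsub
    (ε := s * t) (by positivity)
  refine le_trans (le_of_eq ?_) (key.trans (le_of_eq ?_))
  · congr 1
    ext x
    simp only [Set.mem_ofPred_eq, empMean, Finset.sum_sub_distrib, Finset.sum_const,
      Finset.card_univ, Fintype.card_fin, nsmul_eq_mul]
    rw [le_div_iff₀ hs']
    constructor <;> intro h <;> nlinarith
  · congr 1
    simp
    field_simp

/-- **Hoeffding's inequality** for the lower deviation of the empirical mean. -/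
lemma measureReal_empMean_le_le (P : Measure ℝ) [IsProbabilityMeasure P]
    (hP : P (Set.Icc 0 1) = 1) {s : ℕ} (hs : 0 < s) {t : ℝ} (ht : 0 ≤ t) :
    (Measure.pi fun _ : Fin s => P).real {x | empMean x ≤ meanReward P - t} ≤
      Real.exp (-2 * s * t ^ 2) := by
  have hb : ∀ᵐ y ∂P, y ∈ Set.Icc (0 : ℝ) 1 :=
    (mem_ae_iff_prob_eq_one measurableSet_Icc).2 hP
  have h1 : HasSubgaussianMGF (fun y : ℝ => meanReward P - y) ((‖(1 : ℝ) - 0‖₊ / 2) ^ 2) P := by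
    have := (hasSubgaussianMGF_of_mem_Icc (X := fun y : ℝ => y) aemeasurable_id hb).neg
    refine this.congr (Eventually.of_forall fun y => ?_)
    simp [meanReward]
  have hind : iIndepFun (fun (i : Fin s) (x : Fin s → ℝ) => meanReward P - x i)
      (Measure.pi fun _ : Fin s => P) :=
    iIndepFun_pi (X := fun _ (y : ℝ) => meanReward P - y) fun _ => by fun_prop
  have hsub : ∀ i ∈ (Finset.univ : Finset (Fin s)),
      HasSubgaussianMGF (fun x : Fin s → ℝ => meanReward P - x i)
        ((fun _ => (‖(1 : ℝ) - 0‖₊ / 2) ^ 2) i) (Measure.pi fun _ : Fin s => P) := by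
    intro i _
    have hmp := measurePreserving_eval (fun _ : Fin s => P) i
    refine HasSubgaussianMGF.of_map (Y := fun x : Fin s → ℝ => x i)
      (X := fun y : ℝ => meanReward P - y)
      (measurable_pi_apply i).aemeasurable ?_
    rw [show Measure.map (fun x : Fin s → ℝ => x i) (Measure.pi fun _ : Fin s => P) = P
      from hmp.map_eq]
    exact h1
  have hs' : (0 : ℝ) < s := by exact_mod_cast hs
  have key := HasSubgaussianMGF.measure_sum_ge_le_of_iIndepFun hind hsub
    (ε := s * t) (by positivity)
  refine le_trans (le_of_eq ?_) (key.trans (le_of_eq ?_))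
  · congr 1
    ext x
    simp only [Set.mem_ofPred_eq, empMean, Finset.sum_sub_distrib, Finset.sum_const,
      Finset.card_univ, Fintype.card_fin, nsmul_eq_mul]
    rw [div_le_iff₀ hs']
    constructor <;> intro h <;> nlinarith
  · congr 1
    simp
    field_simp

lemma trial_apply (ε : ℝ) (s : ℕ) (P P' : Measure ℝ) [IsProbabilityMeasure P]
    [IsProbabilityMeasure P'] (w : Bool) :
    trial ε s P P' w = ((Measure.pi fun _ : Fin s => P).prod (Measure.pi fun _ : Fin s => P'))
      {r | trialOutcome ε r = w} := by
  rw [trial, Measure.toPMF_apply, Measure.map_apply (measurable_trialOutcome ε s) (by simp)]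
  rfl

lemma trial_true_add_false (ε : ℝ) (s : ℕ) (P P' : Measure ℝ) [IsProbabilityMeasure P]
    [IsProbabilityMeasure P'] : trial ε s P P' true + trial ε s P P' false = 1 := by
  have := (trial ε s P P').tsum_coe
  rwa [tsum_bool, add_comm] at this

/-- A king whose mean exceeds that of the challenger, minus `0.495 ε`, by `2t`, rarely loses. -/
lemma trial_false_le (ε : ℝ) {s : ℕ} (hs : 0 < s) (P P' : Measure ℝ) [IsProbabilityMeasure P]
    [IsProbabilityMeasure P'] (hP : P (Set.Icc 0 1) = 1) (hP' : P' (Set.Icc 0 1) = 1) {t : ℝ}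
    (ht : 0 ≤ t) (h : meanReward P' - 0.495 * ε + 2 * t ≤ meanReward P) :
    trial ε s P P' false ≤ ENNReal.ofReal (2 * Real.exp (-2 * s * t ^ 2)) := by
  rw [trial_apply, two_mul, ENNReal.ofReal_add (by positivity) (by positivity)]
  have hsub : {r : (Fin s → ℝ) × (Fin s → ℝ) | trialOutcome ε r = false} ⊆
      Prod.fst ⁻¹' {x | empMean x ≤ meanReward P - t} ∪
        Prod.snd ⁻¹' {x | meanReward P' + t ≤ empMean x} := by
    rintro ⟨x, y⟩ hr
    have hr' : empMean x ≤ empMean y - 0.495 * ε := by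
      simpa [trialOutcome, kingWins] using hr
    by_contra hc
    simp only [Set.mem_union, Set.mem_preimage, Set.mem_ofPred_eq, not_or, not_le] at hc
    linarith
  refine (measure_mono hsub).trans ((measure_union_le _ _).trans ?_)
  have hm1 : MeasurableSet {x : Fin s → ℝ | empMean x ≤ meanReward P - t} := by
    unfold empMean; exact measurableSet_le (by fun_prop) (by fun_prop)
  have hm2 : MeasurableSet {x : Fin s → ℝ | meanReward P' + t ≤ empMean x} := by
    unfold empMean; exact measurableSet_le (by fun_prop) (by fun_prop)
  gcongr
  · rw [← Measure.map_apply measurable_fst hm1, Measure.map_fst_prod, measure_univ, one_smul,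
      ← ofReal_measureReal]
    exact ENNReal.ofReal_le_ofReal (measureReal_empMean_le_le P hP hs ht)
  · rw [← Measure.map_apply measurable_snd hm2, Measure.map_snd_prod, measure_univ, one_smul,
      ← ofReal_measureReal]
    exact ENNReal.ofReal_le_ofReal (measureReal_empMean_ge_le P' hP' hs ht)

/-- A king whose mean is smaller than that of the challenger, minus `0.495 ε`, by `2t`,
rarely wins. -/
lemma trial_true_le (ε : ℝ) {s : ℕ} (hs : 0 < s) (P P' : Measure ℝ) [IsProbabilityMeasure P]
    [IsProbabilityMeasure P'] (hP : P (Set.Icc 0 1) = 1) (hP' : P' (Set.Icc 0 1) = 1) {t : ℝ}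
    (ht : 0 ≤ t) (h : meanReward P + 2 * t ≤ meanReward P' - 0.495 * ε) :
    trial ε s P P' true ≤ ENNReal.ofReal (2 * Real.exp (-2 * s * t ^ 2)) := by
  rw [trial_apply, two_mul, ENNReal.ofReal_add (by positivity) (by positivity)]
  have hsub : {r : (Fin s → ℝ) × (Fin s → ℝ) | trialOutcome ε r = true} ⊆
      Prod.fst ⁻¹' {x | meanReward P + t ≤ empMean x} ∪
        Prod.snd ⁻¹' {x | empMean x ≤ meanReward P' - t} := by
    rintro ⟨x, y⟩ hr
    have hr' : empMean y - 0.495 * ε < empMean x := by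
      simpa [trialOutcome, kingWins] using hr
    by_contra hc
    simp only [Set.mem_union, Set.mem_preimage, Set.mem_ofPred_eq, not_or, not_le] at hc
    linarith
  refine (measure_mono hsub).trans ((measure_union_le _ _).trans ?_)
  have hm1 : MeasurableSet {x : Fin s → ℝ | meanReward P + t ≤ empMean x} := by
    unfold empMean; exact measurableSet_le (by fun_prop) (by fun_prop)
  have hm2 : MeasurableSet {x : Fin s → ℝ | empMean x ≤ meanReward P' - t} := by
    unfold empMean; exact measurableSet_le (by fun_prop) (by fun_prop)
  gcongr
  · rw [← Measure.map_apply measurable_fst hm1, Measure.map_fst_prod, measure_univ, one_smul,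
      ← ofReal_measureReal]
    exact ENNReal.ofReal_le_ofReal (measureReal_empMean_ge_le P hP hs ht)
  · rw [← Measure.map_apply measurable_snd hm2, Measure.map_snd_prod, measure_univ, one_smul,
      ← ofReal_measureReal]
    exact ENNReal.ofReal_le_ofReal (measureReal_empMean_le_le P' hP' hs ht)

end Trial

/-! ### Sample sizes and budgets -/

section Sizes

/-- The factor `2 / (ε/200)² · ln (4/δ)` in the sample sizes. -/
def sampleScale (ε δ : ℝ) : ℝ := 2 / (ε / 200) ^ 2 * Real.log (4 / δ)

variable {ε δ : ℝ}

lemma log_four_le (hδ0 : 0 < δ) (hδ1 : δ < 1) : Real.log 4 ≤ Real.log (4 / δ) := by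
  apply Real.log_le_log (by norm_num)
  rw [le_div_iff₀ hδ0]
  linarith

lemma one_le_log_four : 1 ≤ Real.log 4 := by
  rw [show (4 : ℝ) = 2 ^ 2 by norm_num, Real.log_pow]
  have := Real.log_two_gt_d9
  push_cast
  linarith

lemma one_le_sampleScale (hε0 : 0 < ε) (hε1 : ε ≤ 1 / 10) (hδ0 : 0 < δ) (hδ1 : δ < 1) :
    1 ≤ sampleScale ε δ := by
  have h1 : 1 ≤ Real.log (4 / δ) := one_le_log_four.trans (log_four_le hδ0 hδ1)
  have h2 : 1 ≤ 2 / (ε / 200) ^ 2 := by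
    rw [le_div_iff₀ (by positivity)]
    nlinarith
  unfold sampleScale
  nlinarith

/-- Only log (4/δ) ≥ log 4 is kept, so the error bounds derived from this are uniform in `δ`. -/
lemma sampleScale_mul_sq (hε0 : 0 < ε) (hδ0 : 0 < δ) (hδ1 : δ < 1) :
    2 * Real.log 4 ≤ sampleScale ε δ * (ε / 200) ^ 2 := by
  have h1 := log_four_le hδ0 hδ1
  unfold sampleScale
  rw [div_mul_eq_mul_div, div_mul_cancel₀ _ (by positivity)]
  linarith

lemma le_sampleSize (ε δ : ℝ) (ℓ : ℕ) : sampleScale ε δ * 3 ^ ℓ ≤ sampleSize ε δ ℓ :=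
  Nat.le_ceil _

lemma sampleSize_le (h : 0 ≤ sampleScale ε δ) (ℓ : ℕ) :
    (sampleSize ε δ ℓ : ℝ) ≤ sampleScale ε δ * 3 ^ ℓ + 1 :=
  (Nat.ceil_lt_add_one (by positivity)).le

lemma sampleSize_pos (h : 1 ≤ sampleScale ε δ) (ℓ : ℕ) : 0 < sampleSize ε δ ℓ := by
  have h1 := le_sampleSize ε δ ℓ
  have h2 : (0 : ℝ) < sampleScale ε δ * 3 ^ ℓ := by positivity
  exact_mod_cast h2.trans_le h1

lemma le_budgetStep (C ε δ : ℝ) :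
    sampleScale ε δ * C + sampleSize ε δ 1 ≤ budgetStep C ε δ := by
  refine le_trans (le_of_eq ?_) (Nat.le_ceil _)
  unfold sampleScale
  ring

/-- The bound for the probability of a wrong outcome of a trial at level `ℓ`. -/
lemma exp_sampleSize_le (hε0 : 0 < ε) (hδ0 : 0 < δ) (hδ1 : δ < 1) (ℓ : ℕ) :
    2 * Real.exp (-2 * sampleSize ε δ ℓ * (ε / 400) ^ 2) ≤
      2 * Real.exp (-(Real.log 4 * 3 ^ ℓ)) := by
  have h1 := le_sampleSize ε δ ℓ
  have h2 := sampleScale_mul_sq hε0 hδ0 hδ1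
  have h3 : 2 * Real.log 4 * 3 ^ ℓ ≤ sampleScale ε δ * (ε / 200) ^ 2 * 3 ^ ℓ := by gcongr
  have h4 : sampleScale ε δ * 3 ^ ℓ * (ε / 200) ^ 2 ≤ sampleSize ε δ ℓ * (ε / 200) ^ 2 := by
    gcongr
  gcongr
  -- The deviation ε/400 is used because two of them make 0.005 ε, which separates 0.495 ε from the
  -- thresholds 0.49 ε and 0.5 ε.
  have h5 : (ε / 400) ^ 2 = (ε / 200) ^ 2 / 4 := by ring
  rw [h5]
  linarith

/-- Total number of pulls of the king at the levels `1, …, j`. -/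
def levelSum (ε δ : ℝ) (j : ℕ) : ℕ := ∑ i ∈ Finset.range j, sampleSize ε δ (i + 1)

lemma levelSum_succ (ε δ : ℝ) (j : ℕ) :
    levelSum ε δ (j + 1) = levelSum ε δ j + sampleSize ε δ (j + 1) :=
  Finset.sum_range_succ _ _

/-- The geometric sum without the ceilings is half of this bound; the other half absorbs the
rounding, since the scale is at least 1. -/
lemma levelSum_le (h : 1 ≤ sampleScale ε δ) (j : ℕ) :
    (levelSum ε δ j : ℝ) ≤ sampleScale ε δ * (3 * 3 ^ j - 3) := by
  induction j with
  | zero => simp [levelSum]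
  | succ j ih =>
    rw [levelSum_succ]
    push_cast
    have h1 := sampleSize_le (zero_le_one.trans h) (j + 1)
    have h2 : (1 : ℝ) ≤ 3 ^ j := one_le_pow₀ (by norm_num)
    have h3 : 1 ≤ sampleScale ε δ * 3 ^ j := by nlinarith
    rw [pow_succ] at *
    linarith

end Sizes

/-! ### A single challenge -/

section Challenge

variable {ε δ : ℝ} (P P' : Measure ℝ) [IsProbabilityMeasure P] [IsProbabilityMeasure P']

/-- Expected value of `X` at the result of a challenge. -/
def challengeExp (ε δ : ℝ) (P P' : Measure ℝ) [IsProbabilityMeasure P] [IsProbabilityMeasure P']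
    (ℓ Φ : ℕ) (X : Option ℕ → ℝ≥0∞) : ℝ≥0∞ :=
  ∑' r, challenge ε δ P P' ℓ Φ r * X r

lemma challengeExp_mono {ℓ Φ : ℕ} {X Y : Option ℕ → ℝ≥0∞} (h : ∀ r, X r ≤ Y r) :
    challengeExp ε δ P P' ℓ Φ X ≤ challengeExp ε δ P P' ℓ Φ Y :=
  ENNReal.tsum_le_tsum fun r => mul_le_mul_right (h r) _

lemma challengeExp_const (ℓ Φ : ℕ) (c : ℝ≥0∞) :
    challengeExp ε δ P P' ℓ Φ (fun _ => c) = c := by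
  rw [challengeExp, ENNReal.tsum_mul_right, PMF.tsum_coe, one_mul]

lemma challengeExp_add (ℓ Φ : ℕ) (X Y : Option ℕ → ℝ≥0∞) :
    challengeExp ε δ P P' ℓ Φ (fun r => X r + Y r) =
      challengeExp ε δ P P' ℓ Φ X + challengeExp ε δ P P' ℓ Φ Y := by
  simp only [challengeExp, mul_add]
  exact ENNReal.tsum_add

lemma challengeExp_const_mul (ℓ Φ : ℕ) (c : ℝ≥0∞) (X : Option ℕ → ℝ≥0∞) :
    challengeExp ε δ P P' ℓ Φ (fun r => c * X r) = c * challengeExp ε δ P P' ℓ Φ X := by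
  simp only [challengeExp, ← ENNReal.tsum_mul_left]
  exact tsum_congr fun r => by ring

lemma challengeExp_of_lt {ℓ Φ : ℕ} (h : Φ < sampleSize ε δ ℓ) (X : Option ℕ → ℝ≥0∞) :
    challengeExp ε δ P P' ℓ Φ X = X none := by
  rw [challengeExp, challenge, dif_neg (by omega), tsum_eq_single none]
  · simp
  · intro r hr
    simp [PMF.pure_apply, hr]

lemma tsum_bind_mul {α β : Type*} (p : PMF α) (f : α → PMF β) (X : β → ℝ≥0∞) :
    ∑' b, p.bind f b * X b = ∑' a, p a * ∑' b, f a b * X b := by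
  simp only [PMF.bind_apply, ← ENNReal.tsum_mul_right, ← ENNReal.tsum_mul_left]
  rw [ENNReal.tsum_comm]
  exact tsum_congr fun a => tsum_congr fun b => by ring

lemma tsum_pure_mul {β : Type*} (b : β) (X : β → ℝ≥0∞) :
    ∑' c, PMF.pure b c * X c = X b := by
  rw [tsum_eq_single b]
  · simp
  · intro r hr
    simp [PMF.pure_apply, hr]

lemma challengeExp_of_le {ℓ Φ : ℕ} (h0 : 0 < sampleSize ε δ ℓ) (h : sampleSize ε δ ℓ ≤ Φ)
    (X : Option ℕ → ℝ≥0∞) :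
    challengeExp ε δ P P' ℓ Φ X =
      trial ε (sampleSize ε δ ℓ) P P' true * X (some (Φ - sampleSize ε δ ℓ)) +
      trial ε (sampleSize ε δ ℓ) P P' false *
        challengeExp ε δ P P' (ℓ + 1) (Φ - sampleSize ε δ ℓ) X := by
  rw [challengeExp, challenge, dif_pos ⟨h0, h⟩, tsum_bind_mul, tsum_bool, add_comm]
  simp [challengeExp]

/-- The probability that the king wins at the `j`-th level from `ℓ` on, if its budget suffices. -/
def winAt (ε δ : ℝ) (P P' : Measure ℝ) [IsProbabilityMeasure P] [IsProbabilityMeasure P']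
    (ℓ j : ℕ) : ℝ≥0∞ :=
  (∏ i ∈ Finset.range j, trial ε (sampleSize ε δ (ℓ + i)) P P' false) *
    trial ε (sampleSize ε δ (ℓ + j)) P P' true

lemma winAt_zero (ℓ : ℕ) :
    winAt ε δ P P' ℓ 0 = trial ε (sampleSize ε δ ℓ) P P' true := by
  simp [winAt]

lemma winAt_succ (ℓ j : ℕ) : winAt ε δ P P' ℓ (j + 1) =
    trial ε (sampleSize ε δ ℓ) P P' false * winAt ε δ P P' (ℓ + 1) j := by
  have h : ∏ i ∈ Finset.range j, trial ε (sampleSize ε δ (ℓ + (i + 1))) P P' false =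
      ∏ i ∈ Finset.range j, trial ε (sampleSize ε δ (ℓ + 1 + i)) P P' false :=
    Finset.prod_congr rfl fun i _ => by rw [add_assoc, add_comm i]
  rw [winAt, winAt, Finset.prod_range_succ', h, add_assoc ℓ 1 j, add_comm 1 j, add_zero]
  ring

/-- The mass not yet spent after `n` levels is the probability of losing all of them, so the sums
telescope. -/
lemma tsum_winAt_le (ℓ : ℕ) : ∑' j, winAt ε δ P P' ℓ j ≤ 1 := by
  have key : ∀ n, ∑ j ∈ Finset.range n, winAt ε δ P P' ℓ j +
      ∏ i ∈ Finset.range n, trial ε (sampleSize ε δ (ℓ + i)) P P' false = 1 := by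
    intro n
    induction n with
    | zero => simp
    | succ n ih =>
      rw [Finset.sum_range_succ, Finset.prod_range_succ, winAt, add_assoc, ← mul_add,
        trial_true_add_false, mul_one, ih]
  refine ENNReal.tsum_le_of_sum_range_le fun n => ?_
  rw [← key n]
  exact le_self_add

/-- Total number of pulls of the king at `j` levels from `ℓ` on. -/
def levelSumFrom (ε δ : ℝ) (ℓ j : ℕ) : ℕ := ∑ i ∈ Finset.range j, sampleSize ε δ (ℓ + i)

lemma levelSumFrom_one (ε δ : ℝ) (j : ℕ) : levelSumFrom ε δ 1 j = levelSum ε δ j :=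
  Finset.sum_congr rfl fun i _ => by rw [add_comm]

lemma levelSumFrom_succ (ε δ : ℝ) (ℓ j : ℕ) :
    levelSumFrom ε δ ℓ (j + 1) = sampleSize ε δ ℓ + levelSumFrom ε δ (ℓ + 1) j := by
  rw [levelSumFrom, levelSumFrom, Finset.sum_range_succ', add_comm, add_zero]
  congr 1
  exact Finset.sum_congr rfl fun i _ => by rw [add_assoc, add_comm i]

/-- Unrolls the recursion into a series over the winning level. The weights no longer depend on the
budget, which is what makes the budget a walk with identically distributed steps. -/
lemma challengeExp_survive_le (R : ℕ → ℝ≥0∞) (ℓ Φ : ℕ) :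
    challengeExp ε δ P P' ℓ Φ (fun r => r.elim 0 R) ≤
      ∑' j, winAt ε δ P P' ℓ j *
        if levelSumFrom ε δ ℓ (j + 1) ≤ Φ then R (Φ - levelSumFrom ε δ ℓ (j + 1)) else 0 := by
  induction Φ using Nat.strong_induction_on generalizing ℓ with
  | _ Φ ih =>
  by_cases h : 0 < sampleSize ε δ ℓ ∧ sampleSize ε δ ℓ ≤ Φ
  · rw [challengeExp_of_le P P' h.1 h.2, tsum_eq_zero_add' ENNReal.summable]
    refine add_le_add ?_ ?_
    · simp [winAt_zero, levelSumFrom, h.2]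
    · refine (mul_le_mul_right (ih _ (by omega) (ℓ + 1)) _).trans ?_
      rw [← ENNReal.tsum_mul_left]
      refine ENNReal.tsum_le_tsum fun j => ?_
      rw [winAt_succ, levelSumFrom_succ ε δ ℓ (j + 1), mul_assoc]
      gcongr
      have h2 := h.2
      split_ifs with h3 h4 h4
      · rw [Nat.sub_sub]
      · omega
      · exact zero_le
      · exact le_rfl
  · rw [challengeExp, challenge, dif_neg h, tsum_pure_mul]
    simp

/-- The probability that the king is defeated. -/
def defeatProb (ε δ : ℝ) (P P' : Measure ℝ) [IsProbabilityMeasure P] [IsProbabilityMeasure P']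
    (ℓ Φ : ℕ) : ℝ≥0∞ :=
  challenge ε δ P P' ℓ Φ none

lemma challengeExp_defeat (ℓ Φ : ℕ) (c : ℝ≥0∞) :
    challengeExp ε δ P P' ℓ Φ (fun r => r.elim c fun _ => 0) = defeatProb ε δ P P' ℓ Φ * c := by
  rw [challengeExp, tsum_eq_single none]
  · rfl
  · intro r hr
    cases r with
    | none => exact absurd rfl hr
    | some r => simp

lemma defeatProb_le_one (ℓ Φ : ℕ) : defeatProb ε δ P P' ℓ Φ ≤ 1 := PMF.coe_le_one _ _

lemma defeatProb_of_lt {ℓ Φ : ℕ} (h : Φ < sampleSize ε δ ℓ) : defeatProb ε δ P P' ℓ Φ = 1 := by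
  have := challengeExp_of_lt P P' h (fun r => r.elim 1 fun _ => 0)
  rwa [challengeExp_defeat, mul_one] at this

lemma defeatProb_of_le {ℓ Φ : ℕ} (h0 : 0 < sampleSize ε δ ℓ) (h : sampleSize ε δ ℓ ≤ Φ) :
    defeatProb ε δ P P' ℓ Φ = trial ε (sampleSize ε δ ℓ) P P' false *
      defeatProb ε δ P P' (ℓ + 1) (Φ - sampleSize ε δ ℓ) := by
  have := challengeExp_of_le P P' h0 h (fun r => r.elim 1 fun _ => 0)
  simpa [challengeExp_defeat] using this

/-- A king that is not much worse than the challenger is rarely defeated if its budget is large. -/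
lemma defeatProb_le (hs : 1 ≤ sampleScale ε δ)
    (h : ∀ ℓ, 1 ≤ ℓ → trial ε (sampleSize ε δ ℓ) P P' false ≤
      ENNReal.ofReal (2 * Real.exp (-(Real.log 4 * 3 ^ ℓ)))) (Φ m : ℕ)
    (hΦ : sampleSize ε δ (m + 1) ≤ Φ) :
    defeatProb ε δ P P' (m + 1) Φ ≤ ENNReal.ofReal
      (2 * Real.exp (-(Real.log 4 * ((Φ + levelSum ε δ m : ℕ) / (9 * sampleScale ε δ))))) := by
  induction Φ using Nat.strong_induction_on generalizing m with
  | _ Φ ih =>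
  have h0 := sampleSize_pos hs (m + 1)
  rw [defeatProb_of_le P P' h0 hΦ]
  -- Only the last affordable level is charged, the earlier trials being bounded by 1. If level `m +
  -- 1` is the last one, the whole budget is below `levelSum ε δ (m + 2)`, which is at most 9 · 3 ^
  -- (m + 1) times the scale; hence the 9.
  by_cases hlt : Φ - sampleSize ε δ (m + 1) < sampleSize ε δ (m + 1 + 1)
  · rw [defeatProb_of_lt P P' hlt, mul_one]
    refine (h (m + 1) (by omega)).trans ?_
    have hlog : 0 ≤ Real.log 4 := zero_le_one.trans one_le_log_four
    gcongr
    rw [div_le_iff₀ (by positivity)]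
    have h1 : Φ + levelSum ε δ m ≤ levelSum ε δ (m + 2) := by
      rw [levelSum_succ, levelSum_succ]; omega
    have h2 := levelSum_le hs (m + 2)
    have h3 : ((Φ + levelSum ε δ m : ℕ) : ℝ) ≤ levelSum ε δ (m + 2) := by exact_mod_cast h1
    refine (h3.trans h2).trans ?_
    rw [pow_succ, pow_succ]
    nlinarith
  · push Not at hlt
    refine (mul_le_of_le_one_left' (PMF.coe_le_one _ _)).trans ?_
    refine (ih _ (by omega) (m + 1) hlt).trans (le_of_eq ?_)
    rw [levelSum_succ, show Φ - sampleSize ε δ (m + 1) +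
      (levelSum ε δ m + sampleSize ε δ (m + 1)) = Φ + levelSum ε δ m by omega]

/-- A king that is much worse than the challenger is often defeated, whatever its budget. -/
lemma le_defeatProb (h : ∀ ℓ, 1 ≤ ℓ → trial ε (sampleSize ε δ ℓ) P P' true ≤ 2⁻¹ ^ (ℓ + 1))
    (Φ ℓ : ℕ) (hℓ : 1 ≤ ℓ) : 1 ≤ 2⁻¹ ^ ℓ + defeatProb ε δ P P' ℓ Φ := by
  induction Φ using Nat.strong_induction_on generalizing ℓ with
  | _ Φ ih =>
  by_cases hlt : 0 < sampleSize ε δ ℓ ∧ sampleSize ε δ ℓ ≤ Φ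
  · rw [defeatProb_of_le P P' hlt.1 hlt.2]
    have h1 := ih (Φ - sampleSize ε δ ℓ) (by omega) (ℓ + 1) (by omega)
    set L := trial ε (sampleSize ε δ ℓ) P P' false
    set D := defeatProb ε δ P P' (ℓ + 1) (Φ - sampleSize ε δ ℓ)
    have hL : L ≤ 1 := PMF.coe_le_one _ _
    -- The allowance 2⁻¹ ^ ℓ is halved: one half for a win at this level, the other for wins at all
    -- later levels.
    calc (1 : ℝ≥0∞) = trial ε (sampleSize ε δ ℓ) P P' true + L * 1 := by
          rw [mul_one, trial_true_add_false]
      _ ≤ 2⁻¹ ^ (ℓ + 1) + L * (2⁻¹ ^ (ℓ + 1) + D) := by gcongr; exact h ℓ hℓ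
      _ ≤ 2⁻¹ ^ (ℓ + 1) + (1 * 2⁻¹ ^ (ℓ + 1) + L * D) := by rw [mul_add]; gcongr
      _ = 2⁻¹ ^ ℓ * (2⁻¹ + 2⁻¹) + L * D := by rw [pow_succ]; ring
      _ = _ := by rw [ENNReal.inv_two_add_inv_two, mul_one]
  -- Running out of budget counts as a defeat, so a small budget only helps here.
  · have : defeatProb ε δ P P' ℓ Φ = 1 := by
      rw [defeatProb, challenge, dif_neg hlt]; simp
    rw [this]
    exact le_add_self

/-- The left side is 2 to the power 1 - 2 · 3 ^ ℓ, and 3 ^ ℓ ≥ ℓ + 1 by Bernoulli. -/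
lemma ofReal_two_mul_exp_le (ℓ : ℕ) :
    ENNReal.ofReal (2 * Real.exp (-(Real.log 4 * 3 ^ ℓ))) ≤ 2⁻¹ ^ (ℓ + 1) := by
  have h1 : (2⁻¹ : ℝ≥0∞) ^ (ℓ + 1) = ENNReal.ofReal (2 * Real.exp (-(Real.log 2 * (ℓ + 2)))) := by
    rw [show -(Real.log 2 * ((ℓ : ℝ) + 2)) = (ℓ + 2 : ℕ) * -Real.log 2 by push_cast; ring,
      Real.exp_nat_mul, ← Real.log_inv, Real.exp_log (by norm_num), pow_succ _ (ℓ + 1), mul_comm,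
      mul_assoc, inv_mul_cancel₀ two_ne_zero, mul_one, ENNReal.ofReal_pow (by norm_num),
      ENNReal.ofReal_inv_of_pos (by norm_num)]
    simp
  rw [h1]
  apply ENNReal.ofReal_le_ofReal
  have h4 : Real.log 4 = 2 * Real.log 2 := by
    rw [show (4 : ℝ) = 2 ^ 2 by norm_num, Real.log_pow]; norm_num
  rw [h4]
  refine mul_le_mul_of_nonneg_left (Real.exp_le_exp.2 (neg_le_neg ?_)) (by norm_num)
  have h2 : ((ℓ : ℝ) + 1) ≤ 3 ^ ℓ := by
    have := one_add_mul_le_pow (show (-2 : ℝ) ≤ 2 by norm_num) ℓ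
    norm_num at this
    have h0 : (0 : ℝ) ≤ ℓ := by positivity
    linarith
  have h3 : 0 < Real.log 2 := Real.log_pos (by norm_num)
  have h0 : (0 : ℝ) ≤ ℓ := by positivity
  nlinarith

end Challenge

/-! ### Measurability in the arms -/

lemma measurable_meanReward {A : Type*} [MeasurableSpace A] (κ : Kernel A ℝ) :
    Measurable fun a => meanReward (κ a) :=
  (StronglyMeasurable.integral_kernel (κ := κ) (f := fun x : ℝ => x)
    stronglyMeasurable_id).measurable

section Measurability

variable {A : Type*} [MeasurableSpace A] (κ : Kernel A ℝ) [IsMarkovKernel κ]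

lemma measurable_pi_kernel (s : ℕ) : Measurable fun a => Measure.pi fun _ : Fin s => κ a := by
  refine Measurable.measure_of_isPiSystem_of_isProbabilityMeasure generateFrom_pi.symm
    isPiSystem_pi ?_
  rintro _ ⟨t, ht, rfl⟩
  simp only [Measure.pi_pi]
  exact Finset.measurable_prod _ fun i _ => κ.measurable_coe (ht i (Set.mem_univ i))

lemma measurable_trial (ε : ℝ) (s : ℕ) (w : Bool) :
    Measurable fun p : A × A => trial ε s (κ p.1) (κ p.2) w := by
  simp only [trial_apply]
  have hw : MeasurableSet {r : (Fin s → ℝ) × (Fin s → ℝ) | trialOutcome ε r = w} :=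
    measurable_trialOutcome ε s (measurableSet_singleton w)
  let η : Kernel A (Fin s → ℝ) := ⟨_, measurable_pi_kernel κ s⟩
  have hη : IsMarkovKernel η :=
    ⟨fun a => inferInstanceAs (IsProbabilityMeasure (Measure.pi fun _ : Fin s => κ a))⟩
  have := (Kernel.parallelComp η η).measurable_coe hw
  simp only [Kernel.parallelComp_apply] at this
  exact this

lemma measurable_challenge (ε δ : ℝ) (ℓ Φ : ℕ) (r : Option ℕ) :
    Measurable fun p : A × A => challenge ε δ (κ p.1) (κ p.2) ℓ Φ r := by
  induction Φ using Nat.strong_induction_on generalizing ℓ with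
  | _ Φ ih =>
  by_cases h : 0 < sampleSize ε δ ℓ ∧ sampleSize ε δ ℓ ≤ Φ
  · have : ∀ p : A × A, challenge ε δ (κ p.1) (κ p.2) ℓ Φ r =
        trial ε (sampleSize ε δ ℓ) (κ p.1) (κ p.2) false *
          challenge ε δ (κ p.1) (κ p.2) (ℓ + 1) (Φ - sampleSize ε δ ℓ) r +
        trial ε (sampleSize ε δ ℓ) (κ p.1) (κ p.2) true *
          PMF.pure (some (Φ - sampleSize ε δ ℓ)) r := by
      intro p
      rw [challenge, dif_pos h, PMF.bind_apply, tsum_bool]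
      simp
    simp only [this]
    exact ((measurable_trial κ ε _ _).mul (ih _ (by omega) _)).add
      ((measurable_trial κ ε _ _).mul_const _)
  · have : ∀ p : A × A, challenge ε δ (κ p.1) (κ p.2) ℓ Φ r = PMF.pure none r := by
      intro p
      rw [challenge, dif_neg h]
    simp only [this]
    exact measurable_const

lemma measurable_winAt (ε δ : ℝ) (ℓ j : ℕ) :
    Measurable fun p : A × A => winAt ε δ (κ p.1) (κ p.2) ℓ j :=
  (Finset.measurable_prod _ fun _ _ => measurable_trial κ ε _ _).mul (measurable_trial κ ε _ _)

lemma measurable_challengeExp {B : Type*} [MeasurableSpace B] (ε δ : ℝ) (ℓ Φ : ℕ) {f g : B → A}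
    (hf : Measurable f) (hg : Measurable g) {X : B → Option ℕ → ℝ≥0∞}
    (hX : ∀ r, Measurable fun c => X c r) :
    Measurable fun c => challengeExp ε δ (κ (f c)) (κ (g c)) ℓ Φ (X c) :=
  Measurable.tsum fun r =>
    ((measurable_challenge κ ε δ ℓ Φ r).comp (hf.prodMk hg)).mul (hX r)

lemma measurable_processStream (C ε δ : ℝ) {n : ℕ} (l : List (Fin n)) (st st' : Fin n × ℕ) :
    Measurable fun arm : ℕ → A =>
      processStream C ε δ (fun i : Fin n => κ (arm i)) l st st' := by
  induction l generalizing st with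
  | nil => exact measurable_const
  | cons i l ih =>
    have : ∀ arm : ℕ → A, processStream C ε δ (fun i : Fin n => κ (arm i)) (i :: l) st st' =
        ∑' r, challenge ε δ (κ (arm st.1)) (κ (arm i)) 1 (st.2 + budgetStep C ε δ) r *
          processStream C ε δ (fun i : Fin n => κ (arm i)) l
            (match r with | some φ => (st.1, φ) | none => (i, 0)) st' := by
      intro arm
      rw [processStream, processArm, PMF.bind_map, PMF.bind_apply]
      rfl
    simp only [this]
    refine Measurable.tsum fun r => ?_
    exact ((measurable_challenge κ ε δ 1 _ r).comp
      ((measurable_pi_apply _).prodMk (measurable_pi_apply _))).mul (ih _)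

lemma measurable_algorithm (C ε δ : ℝ) {n : ℕ} (l : List (Fin n)) (o : Option (Fin n)) :
    Measurable fun arm : ℕ → A => algorithm C ε δ (fun i : Fin n => κ (arm i)) l o := by
  classical
  cases l with
  | nil => exact measurable_const
  | cons i l =>
    simp only [algorithm, PMF.map_apply]
    refine Measurable.tsum fun st => ?_
    by_cases h : o = some st.1
    · simpa [h] using measurable_processStream κ C ε δ l (i, 0) st
    · simp [h]

lemma measurable_successProb (C ε δ : ℝ) (n : ℕ) :
    Measurable fun arm : ℕ → A => successProb C ε δ (fun i : Fin n => κ (arm i)) := by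
  classical
  have hm := measurable_meanReward κ
  have hset : ∀ i : Fin n,
      MeasurableSet {arm : ℕ → A | IsEpsBest (fun i : Fin n => κ (arm i)) ε i} := by
    intro i
    unfold IsEpsBest
    refine measurableSet_le (Measurable.sub_const ?_ _) (hm.comp (measurable_pi_apply _))
    exact Measurable.iSup fun j => hm.comp (measurable_pi_apply _)
  unfold successProb algorithmRandomOrder
  refine Measurable.ennreal_toReal ?_
  simp only [PMF.toOuterMeasure_apply]
  refine Measurable.tsum fun o => ?_
  simp only [Set.indicator_apply]
  refine Measurable.ite ?_ ?_ measurable_const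
  · cases o with
    | none => simp
    | some i =>
      convert hset i using 1
      ext arm
      simp
  · simp only [PMF.bind_apply]
    exact Measurable.tsum fun σ => (measurable_algorithm κ C ε δ _ o).const_mul _

end Measurability

/-! ### Independent sequences of arms -/

section Shift

variable {A : Type*} [MeasurableSpace A] (Q : Measure A) [IsProbabilityMeasure Q]

/-- The first element of an independent sequence is independent of the rest. -/
lemma lintegral_infinitePi_cons (f : A → (ℕ → A) → ℝ≥0∞) (hf : Measurable (Function.uncurry f)) :
    ∫⁻ ω, f (ω 0) (fun i => ω (i + 1)) ∂(Measure.infinitePi fun _ : ℕ => Q) =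
      ∫⁻ a, ∫⁻ ω, f a ω ∂(Measure.infinitePi fun _ : ℕ => Q) ∂Q := by
  let c : A × (ℕ → A) → ℕ → A := fun p i => i.casesOn p.1 p.2
  have hc : Measurable c := by
    refine measurable_pi_lambda _ fun i => ?_
    cases i with
    | zero => exact measurable_fst
    | succ i => exact (measurable_pi_apply i).comp measurable_snd
  -- Prepending a fresh term preserves the product law. This is checked on boxes, according to
  -- whether coordinate 0 is constrained.
  have hmap : (Q.prod (Measure.infinitePi fun _ : ℕ => Q)).map c =
      Measure.infinitePi fun _ : ℕ => Q := by
    refine Measure.eq_infinitePi _ fun s t ht => ?_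
    rw [Measure.map_apply hc (.pi s.countable_toSet fun i _ => ht i)]
    have hpre : c ⁻¹' (Set.pi s t) = (if 0 ∈ s then t 0 else Set.univ) ×ˢ
        Set.pi (s.preimage Nat.succ Nat.succ_injective.injOn : Finset ℕ) (fun i => t (i + 1)) := by
      ext ⟨a, ω⟩
      simp only [Set.mem_preimage, Set.mem_pi, Set.mem_prod, Finset.mem_coe, Finset.mem_preimage]
      constructor
      · intro h
        refine ⟨?_, fun i hi => h (i + 1) hi⟩
        split_ifs with h0
        · exact h 0 h0
        · trivial
      · rintro ⟨h1, h2⟩ i hi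
        cases i with
        | zero => rw [if_pos hi] at h1; exact h1
        | succ i => exact h2 i hi
    rw [hpre, Measure.prod_prod, Measure.infinitePi_pi _ fun i _ => ht (i + 1)]
    have h1 : Q (if 0 ∈ s then t 0 else Set.univ) = if 0 ∈ s then Q (t 0) else 1 := by
      split_ifs <;> simp
    have h2 : ∏ i ∈ s.preimage Nat.succ Nat.succ_injective.injOn, Q (t (i + 1)) =
        ∏ i ∈ s.erase 0, Q (t i) := by
      refine Finset.prod_nbij Nat.succ ?_ Nat.succ_injective.injOn ?_ fun i _ => rfl
      · intro i hi
        simpa using hi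
      · intro i hi
        simp only [Finset.coe_erase, Set.mem_sdiff, Finset.mem_coe, Set.mem_singleton_iff] at hi
        obtain ⟨j, rfl⟩ := Nat.exists_eq_succ_of_ne_zero hi.2
        exact ⟨j, by simpa using hi.1, rfl⟩
    rw [h1, h2]
    split_ifs with h0
    · exact Finset.mul_prod_erase s (fun i => Q (t i)) h0
    · rw [one_mul, Finset.erase_eq_of_notMem h0]
  conv_lhs => rw [← hmap]
  rw [lintegral_map _ hc]
  · exact lintegral_prod _ hf.aemeasurable
  · have hsh : Measurable fun ω : ℕ → A => (ω 0, fun i => ω (i + 1)) :=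
      (measurable_pi_apply 0).prodMk (measurable_pi_lambda _ fun i => measurable_pi_apply (i + 1))
    exact hf.comp hsh

end Shift

/-! ### Leaving the good zone -/

section Leave

variable {A : Type*} [MeasurableSpace A] (κ : Kernel A ℝ) [IsMarkovKernel κ]

open Classical in
/-- The probability that a king with mean less than `θ` reigns at some time from `N` to `M`,
if king `k` has budget `φ` at time `0` and the arms `ω` arrive. -/
def leaveProb (C ε δ θ : ℝ) : ℕ → ℕ → (ℕ → A) → A → ℕ → ℝ≥0∞
  | _, 0, _, k, _ => if meanReward (κ k) < θ then 1 else 0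
  -- The truncated `N - 1` stays at 0 once it is reached, so from time `N` on every king is tested.
  -- At `M = 0` the king is tested whatever `N` is.
  | N, M + 1, ω, k, φ => if N = 0 ∧ meanReward (κ k) < θ then 1 else
      challengeExp ε δ (κ k) (κ (ω 0)) 1 (φ + budgetStep C ε δ) fun r =>
        r.elim (leaveProb C ε δ θ (N - 1) M (fun i => ω (i + 1)) (ω 0) 0)
          (leaveProb C ε δ θ (N - 1) M (fun i => ω (i + 1)) k)

open Classical in
/-- The mean of `leaveProb` for independent arriving arms with law `Q`. -/
def meanLeaveProb (C ε δ θ : ℝ) (Q : Measure A) : ℕ → ℕ → A → ℕ → ℝ≥0∞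
  | _, 0, k, _ => if meanReward (κ k) < θ then 1 else 0
  | N, M + 1, k, φ => if N = 0 ∧ meanReward (κ k) < θ then 1 else
      ∫⁻ a, challengeExp ε δ (κ k) (κ a) 1 (φ + budgetStep C ε δ) (fun r =>
        r.elim (meanLeaveProb C ε δ θ Q (N - 1) M a 0)
          (meanLeaveProb C ε δ θ Q (N - 1) M k)) ∂Q

variable (C ε δ θ : ℝ)

lemma measurable_leaveProb (N M φ : ℕ) :
    Measurable fun p : (ℕ → A) × A => leaveProb κ C ε δ θ N M p.1 p.2 φ := by
  have hm := measurable_meanReward κ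
  have hset : MeasurableSet {p : (ℕ → A) × A | meanReward (κ p.2) < θ} :=
    measurableSet_lt (hm.comp measurable_snd) measurable_const
  induction M generalizing N φ with
  | zero => exact Measurable.ite hset measurable_const measurable_const
  | succ M ih =>
    have hsh : Measurable fun p : (ℕ → A) × A => fun i => p.1 (i + 1) :=
      measurable_pi_lambda _ fun i => (measurable_pi_apply (i + 1)).comp measurable_fst
    have h0 : Measurable fun p : (ℕ → A) × A => p.1 0 :=
      (measurable_pi_apply 0).comp measurable_fst
    refine Measurable.ite ?_ measurable_const
      (measurable_challengeExp κ ε δ 1 _ measurable_snd h0 fun r => ?_)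
    · by_cases hN : N = 0
      · simpa [hN] using hset
      · simp [hN]
    · cases r with
      | none => exact (ih (N - 1) 0).comp (hsh.prodMk h0)
      | some φ' => exact (ih (N - 1) φ').comp (hsh.prodMk measurable_snd)

lemma leaveProb_le_one (N M : ℕ) (ω : ℕ → A) (k : A) (φ : ℕ) :
    leaveProb κ C ε δ θ N M ω k φ ≤ 1 := by
  induction M generalizing N ω k φ with
  | zero => rw [leaveProb]; split_ifs <;> simp
  | succ M ih =>
    rw [leaveProb]
    split_ifs
    · exact le_rfl
    · rw [← challengeExp_const (ε := ε) (δ := δ) (κ k) (κ (ω 0)) 1 (φ + budgetStep C ε δ) 1]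
      refine challengeExp_mono _ _ fun r => ?_
      cases r
      · exact ih _ _ _ _
      · exact ih _ _ _ _

/-- One more arrival only adds a king to be tested. `N ≤ M` is needed because the king at time `M`
is tested even when `M` precedes `N`. -/
lemma leaveProb_mono_right (N M : ℕ) (ω : ℕ → A) (k : A) (φ : ℕ) (hNM : N ≤ M) :
    leaveProb κ C ε δ θ N M ω k φ ≤ leaveProb κ C ε δ θ N (M + 1) ω k φ := by
  induction M generalizing N ω k φ with
  | zero =>
    obtain rfl : N = 0 := by omega
    rw [leaveProb, leaveProb]
    split_ifs with h1 h2 h2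
    · exact le_rfl
    · exact absurd ⟨rfl, h1⟩ h2
    · exact zero_le
    · exact zero_le
  | succ M ih =>
    rw [leaveProb, leaveProb]
    split_ifs
    · exact le_rfl
    · refine challengeExp_mono _ _ fun r => ?_
      cases r
      · exact ih _ _ _ _ (by omega)
      · exact ih _ _ _ _ (by omega)

lemma leaveProb_congr (N M : ℕ) {ω ω' : ℕ → A} (h : ∀ i < M, ω i = ω' i) (k : A) (φ : ℕ) :
    leaveProb κ C ε δ θ N M ω k φ = leaveProb κ C ε δ θ N M ω' k φ := by
  induction M generalizing N ω ω' k φ with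
  | zero => rfl
  | succ M ih =>
    have ih' := fun N k φ => ih N (fun i hi => h (i + 1) (by omega)) k φ
    have hf : ∀ N k, leaveProb κ C ε δ θ N M (fun i => ω (i + 1)) k =
        leaveProb κ C ε δ θ N M (fun i => ω' (i + 1)) k := fun N k => funext fun φ => ih' N k φ
    simp only [leaveProb, h 0 (by omega), hf]

lemma lintegral_leaveProb (Q : Measure A) [IsProbabilityMeasure Q] (N M : ℕ) (k : A) (φ : ℕ) :
    ∫⁻ ω, leaveProb κ C ε δ θ N M ω k φ ∂(Measure.infinitePi fun _ : ℕ => Q) =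
      meanLeaveProb κ C ε δ θ Q N M k φ := by
  induction M generalizing N k φ with
  | zero => simp [leaveProb, meanLeaveProb]
  | succ M ih =>
    simp only [leaveProb, meanLeaveProb]
    split_ifs with h
    · simp
    · let X : A → (ℕ → A) → Option ℕ → ℝ≥0∞ := fun a ω r =>
        r.elim (leaveProb κ C ε δ θ (N - 1) M ω a 0) (leaveProb κ C ε δ θ (N - 1) M ω k)
      have hX : ∀ r, Measurable fun p : A × (ℕ → A) => X p.1 p.2 r := by
        intro r
        cases r with
        | none =>
          exact (measurable_leaveProb κ C ε δ θ (N - 1) M 0).comp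
            (measurable_snd.prodMk measurable_fst)
        | some φ' =>
          exact (measurable_leaveProb κ C ε δ θ (N - 1) M φ').comp
            (measurable_snd.prodMk measurable_const)
      rw [lintegral_infinitePi_cons Q (fun a ω =>
        challengeExp ε δ (κ k) (κ a) 1 (φ + budgetStep C ε δ) (X a ω))]
      · refine lintegral_congr fun a => ?_
        simp only [challengeExp]
        rw [lintegral_tsum]
        · refine tsum_congr fun r => ?_
          have hr : Measurable fun ω => X a ω r := (hX r).comp (measurable_const.prodMk measurable_id)
          rw [lintegral_const_mul _ hr]
          congr 1
          cases r with
          | none => exact ih _ _ _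
          | some φ' => exact ih _ _ _
        · intro r
          have hr : Measurable fun ω => X a ω r := (hX r).comp (measurable_const.prodMk measurable_id)
          exact (hr.const_mul _).aemeasurable
      · exact measurable_challengeExp κ ε δ 1 _ measurable_const measurable_fst hX

end Leave

/-! ### The final king -/

section Final

variable {A : Type*} [MeasurableSpace A] (κ : Kernel A ℝ) [IsMarkovKernel κ] {n : ℕ}

open Classical in
/-- The probability that the final king has mean less than `θ`. -/
lemma processStream_le_leaveProb (C ε δ θ : ℝ) (arm : Fin n → A) (l : List (Fin n)) (N : ℕ)
    (ω : ℕ → A) (hω : ∀ i (h : i < l.length), ω i = arm l[i]) (k : Fin n) (φ : ℕ) :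
    ∑' st, processStream C ε δ (fun i => κ (arm i)) l (k, φ) st *
      (if meanReward (κ (arm st.1)) < θ then 1 else 0) ≤
        leaveProb κ C ε δ θ N l.length ω (arm k) φ := by
  induction l generalizing N ω k φ with
  | nil =>
    rw [processStream, tsum_pure_mul]
    exact le_rfl
  | cons i l ih =>
    have h0 : ω 0 = arm i := hω 0 (by simp)
    rw [List.length_cons, leaveProb]
    split_ifs with h
    · calc _ ≤ ∑' st, processStream C ε δ (fun i => κ (arm i)) (i :: l) (k, φ) st := by
            refine ENNReal.tsum_le_tsum fun st => mul_le_of_le_one_right' ?_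
            split_ifs <;> simp
        _ = 1 := PMF.tsum_coe _
    · rw [processStream, processArm, PMF.bind_map, tsum_bind_mul, challengeExp]
      simp only [h0]
      refine ENNReal.tsum_le_tsum fun r => mul_le_mul_right ?_ _
      have hω' : ∀ j (h : j < l.length), ω (j + 1) = arm l[j] := fun j hj =>
        hω (j + 1) (by simpa using hj)
      cases r with
      | none => exact ih (N - 1) _ hω' i 0
      | some φ' => exact ih (N - 1) _ hω' k φ'

end Final

/-- The values of the distribution function below `η` have probability at most `η`. -/
lemma measure_measure_Iic_lt_le (D : Measure ℝ) [IsFiniteMeasure D] (η : ℝ≥0∞) :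
    D {x | D (Set.Iic x) < η} ≤ η := by
  have hlow : IsLowerSet {x | D (Set.Iic x) < η} := fun x y hyx hx =>
    (measure_mono (Set.Iic_subset_Iic.2 hyx)).trans_lt hx
  have hmeas : MeasurableSet {x | D (Set.Iic x) < η} := hlow.ordConnected.measurableSet
  -- Inner regularity replaces the set by a compact subset, whose greatest element `x` belongs to
  -- the set; the subset lies in `Set.Iic x`.
  rw [hmeas.measure_eq_iSup_isCompact]
  refine iSup₂_le fun K hK => iSup_le fun hc => ?_
  rcases K.eq_empty_or_nonempty with rfl | hne
  · simp
  · obtain ⟨x, hx, hmax⟩ := hc.exists_isGreatest hne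
    exact (measure_mono fun y hy => hmax hy).trans (le_of_lt (hK hx))

lemma lintegral_const_add_tsum_mul {A : Type*} [MeasurableSpace A] (Q : Measure A)
    [IsProbabilityMeasure Q] (c : ℝ≥0∞) {w : ℕ → A → ℝ≥0∞} (hw : ∀ j, Measurable (w j))
    (d : ℕ → ℝ≥0∞) :
    ∫⁻ a, c + ∑' j, w j a * d j ∂Q = c + ∑' j, (∫⁻ a, w j a ∂Q) * d j := by
  rw [lintegral_add_left measurable_const, lintegral_const, measure_univ, mul_one,
    lintegral_tsum fun j => ((hw j).mul_const _).aemeasurable]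
  congr 1
  exact tsum_congr fun j => lintegral_mul_const _ (hw j)

/-! ### Reigns of kings in an i.i.d. stream -/

section Reigns

variable {A : Type*} [MeasurableSpace A] (κ : Kernel A ℝ) [IsMarkovKernel κ]
  {C ε δ θ : ℝ} (Q : Measure A) [IsProbabilityMeasure Q]

lemma meanLeaveProb_le_one (N M : ℕ) (k : A) (φ : ℕ) :
    meanLeaveProb κ C ε δ θ Q N M k φ ≤ 1 := by
  rw [← lintegral_leaveProb]
  refine (lintegral_mono fun ω => leaveProb_le_one κ C ε δ θ N M ω k φ).trans ?_
  simp

lemma meanLeaveProb_le_zero_left (N M : ℕ) (k : A) (φ : ℕ) :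
    meanLeaveProb κ C ε δ θ Q N M k φ ≤ meanLeaveProb κ C ε δ θ Q 0 M k φ := by
  induction M generalizing N k φ with
  | zero => exact le_rfl
  | succ M ih =>
    by_cases h : meanReward (κ k) < θ
    · have h1 : meanLeaveProb κ C ε δ θ Q 0 (M + 1) k φ = 1 := by
        rw [meanLeaveProb, if_pos ⟨rfl, h⟩]
      rw [h1]
      exact meanLeaveProb_le_one κ Q _ _ _ _
    · rw [meanLeaveProb, meanLeaveProb, if_neg (by tauto), if_neg (by tauto)]
      refine lintegral_mono fun a => challengeExp_mono _ _ fun r => ?_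
      cases r
      · exact ih _ _ _
      · exact ih _ _ _

variable (hε0 : 0 < ε) (hε1 : ε ≤ 1 / 10) (hδ0 : 0 < δ) (hδ1 : δ < 1)
  (hκ : ∀ a, κ a (Set.Icc 0 1) = 1)

include hκ in
lemma meanReward_le_one (a : A) : meanReward (κ a) ≤ 1 := by
  have hb : ∀ᵐ y ∂(κ a), y ∈ Set.Icc (0 : ℝ) 1 :=
    (mem_ae_iff_prob_eq_one measurableSet_Icc).2 (hκ a)
  have hint : Integrable (fun y : ℝ => y) (κ a) := Integrable.of_mem_Icc 0 1 aemeasurable_id hb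
  calc meanReward (κ a) ≤ ∫ _, (1 : ℝ) ∂(κ a) :=
        integral_mono_ae hint (integrable_const _) (hb.mono fun y hy => hy.2)
    _ = 1 := by simp

include hε0 hε1 hδ0 hδ1 hκ

lemma trial_false_le_of_mean_le {k a : A} (h : meanReward (κ a) ≤ meanReward (κ k) + 0.49 * ε)
    (ℓ : ℕ) : trial ε (sampleSize ε δ ℓ) (κ k) (κ a) false ≤
      ENNReal.ofReal (2 * Real.exp (-(Real.log 4 * 3 ^ ℓ))) := by
  have hs := one_le_sampleScale hε0 hε1 hδ0 hδ1
  refine (trial_false_le ε (sampleSize_pos hs ℓ) _ _ (hκ k) (hκ a) (t := ε / 400)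
    (by positivity) (by linarith)).trans ?_
  exact ENNReal.ofReal_le_ofReal (exp_sampleSize_le hε0 hδ0 hδ1 ℓ)

lemma trial_true_le_of_le_mean {k a : A} (h : meanReward (κ k) + 0.5 * ε ≤ meanReward (κ a))
    (ℓ : ℕ) : trial ε (sampleSize ε δ ℓ) (κ k) (κ a) true ≤ 2⁻¹ ^ (ℓ + 1) := by
  have hs := one_le_sampleScale hε0 hε1 hδ0 hδ1
  refine (trial_true_le ε (sampleSize_pos hs ℓ) _ _ (hκ k) (hκ a) (t := ε / 400)
    (by positivity) (by linarith)).trans ?_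
  exact (ENNReal.ofReal_le_ofReal (exp_sampleSize_le hε0 hδ0 hδ1 ℓ)).trans
    (ofReal_two_mul_exp_le ℓ)

/-- Bound for the probability that a king with budget `y` is defeated by an arm that is not much
better. -/
def defeatBound (C ε δ : ℝ) (y : ℤ) : ℝ≥0∞ :=
  ENNReal.ofReal
    (2 * Real.exp (-(Real.log 4 * ((y + budgetStep C ε δ) / (9 * sampleScale ε δ)))))

/-- Change of the budget when the king wins at level `j + 1`. -/
def budgetChange (C ε δ : ℝ) (j : ℕ) : ℤ := (budgetStep C ε δ : ℤ) - levelSum ε δ (j + 1)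

/-- The probability that king `k` wins against a random arm at level `j + 1`. -/
def winWeight (ε δ : ℝ) (k : A) (j : ℕ) : ℝ≥0∞ := ∫⁻ a, winAt ε δ (κ k) (κ a) 1 j ∂Q

omit hε0 hε1 hδ0 hδ1 hκ in
lemma tsum_winWeight_le (k : A) : ∑' j, winWeight κ Q ε δ k j ≤ 1 := by
  unfold winWeight
  have hm : ∀ j, Measurable fun a => winAt ε δ (κ k) (κ a) 1 j := fun j =>
    (measurable_winAt κ ε δ 1 j).comp (measurable_const.prodMk measurable_id)
  rw [← lintegral_tsum fun j => (hm j).aemeasurable]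
  refine (lintegral_mono fun a => tsum_winAt_le (κ k) (κ a) 1).trans ?_
  simp

omit [IsMarkovKernel κ] hκ in
lemma antitone_defeatBound : Antitone (defeatBound C ε δ) := by
  intro y z h
  have hs := one_le_sampleScale hε0 hε1 hδ0 hδ1
  have hlog : 0 ≤ Real.log 4 := zero_le_one.trans one_le_log_four
  unfold defeatBound
  gcongr

-- Recasts the budget as an integer walk: the levels up to the winning one are affordable exactly
-- when the walk stays nonnegative.
omit [MeasurableSpace A] [IsMarkovKernel κ] hε0 hε1 hδ0 hδ1 hκ in
lemma challengeExp_survive_le_budgetChange (P P' : Measure ℝ) [IsProbabilityMeasure P]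
    [IsProbabilityMeasure P'] (f : ℤ → ℝ≥0∞) (φ : ℕ) :
    challengeExp ε δ P P' 1 (φ + budgetStep C ε δ) (fun r => r.elim 0 fun φ' => f φ') ≤
      ∑' j, winAt ε δ P P' 1 j *
        if 0 ≤ (φ : ℤ) + budgetChange C ε δ j then f (φ + budgetChange C ε δ j) else 0 := by
  refine (challengeExp_survive_le P P' (fun φ' => f φ') 1 _).trans ?_
  refine ENNReal.tsum_le_tsum fun j => mul_le_mul_right ?_ _
  rw [levelSumFrom_one]
  have hx : (φ : ℤ) + budgetChange C ε δ j =
      ((φ + budgetStep C ε δ : ℕ) : ℤ) - levelSum ε δ (j + 1) := by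
    rw [budgetChange]; push_cast; ring
  by_cases h : levelSum ε δ (j + 1) ≤ φ + budgetStep C ε δ
  · rw [if_pos h, if_pos (by rw [hx]; omega), hx, Nat.cast_sub h]
  · rw [if_neg h]; exact zero_le

/-- Since `C` is nonnegative, the amount added on arrival already pays for level 1, so
`defeatProb_le` applies with no level used up. -/
lemma defeatProb_le_defeatBound {k a : A} (hC : 0 ≤ C)
    (h : meanReward (κ a) ≤ meanReward (κ k) + 0.49 * ε) (φ : ℕ) :
    defeatProb ε δ (κ k) (κ a) 1 (φ + budgetStep C ε δ) ≤ defeatBound C ε δ φ := by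
  have hs := one_le_sampleScale hε0 hε1 hδ0 hδ1
  have hΦ : sampleSize ε δ (0 + 1) ≤ φ + budgetStep C ε δ := by
    have h1 := le_budgetStep C ε δ
    have h2 : (0 : ℝ) ≤ sampleScale ε δ * C := mul_nonneg (zero_le_one.trans hs) hC
    have h3 : (sampleSize ε δ 1 : ℝ) ≤ budgetStep C ε δ := by linarith
    have h4 : sampleSize ε δ 1 ≤ budgetStep C ε δ := by exact_mod_cast h3
    rw [zero_add]; omega
  have := defeatProb_le (κ k) (κ a) hs (fun ℓ _ =>
    trial_false_le_of_mean_le κ hε0 hε1 hδ0 hδ1 hκ h ℓ) (φ + budgetStep C ε δ) 0 hΦ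
  rwa [levelSum, Finset.sum_range_zero, add_zero, zero_add, Nat.cast_add,
    ← Int.cast_natCast (R := ℝ) φ] at this

/-- The zone can only be left after the reign of `k` ends. If a much better arm ends it, the
remaining risk is at most `τ`; as this happens at most once, `τ` is paid only once. Any other defeat
counts as leaving and is charged at the current budget, which produces the recursion of
`killedCost`. -/
lemma meanLeaveProb_le_add_killedCost (k : A) (hC : 0 ≤ C) (hk : θ ≤ meanReward (κ k)) {τ : ℝ≥0∞}
    (hτ : ∀ a M, meanReward (κ k) + 0.49 * ε < meanReward (κ a) →
      meanLeaveProb κ C ε δ θ Q 0 M a 0 ≤ τ) (M φ : ℕ) :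
    meanLeaveProb κ C ε δ θ Q 0 M k φ ≤ τ + killedCost (winWeight κ Q ε δ k)
      (budgetChange C ε δ) (defeatBound C ε δ) M φ := by
  classical
  have hs := one_le_sampleScale hε0 hε1 hδ0 hδ1
  induction M generalizing φ with
  | zero => rw [meanLeaveProb, if_neg (not_lt.2 hk)]; exact zero_le
  | succ M ih =>
    rw [meanLeaveProb, if_neg (fun h => not_lt.2 hk h.2), killedCost]
    set R : ℕ → ℝ≥0∞ := fun φ' => killedCost (winWeight κ Q ε δ k)
      (budgetChange C ε δ) (defeatBound C ε δ) M φ' with hR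
    set c : ℕ → ℝ≥0∞ := fun j => if 0 ≤ (φ : ℤ) + budgetChange C ε δ j then
      killedCost (winWeight κ Q ε δ k) (budgetChange C ε δ) (defeatBound C ε δ) M
        (φ + budgetChange C ε δ j) else 0 with hc
    have hmw : ∀ j, Measurable fun a => winAt ε δ (κ k) (κ a) 1 j := fun j =>
      (measurable_winAt κ ε δ 1 j).comp (measurable_const.prodMk measurable_id)
    have hpt : ∀ a, challengeExp ε δ (κ k) (κ a) 1 (φ + budgetStep C ε δ) (fun r =>
        r.elim (meanLeaveProb κ C ε δ θ Q (0 - 1) M a 0)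
          (meanLeaveProb κ C ε δ θ Q (0 - 1) M k)) ≤
        (τ + defeatBound C ε δ φ) + ∑' j, winAt ε δ (κ k) (κ a) 1 j * c j := by
      intro a
      set g : ℝ≥0∞ := if meanReward (κ k) + 0.49 * ε < meanReward (κ a) then 0 else 1 with hg
      have h1 : ∀ r : Option ℕ, r.elim (meanLeaveProb κ C ε δ θ Q (0 - 1) M a 0)
          (meanLeaveProb κ C ε δ θ Q (0 - 1) M k) ≤
          (τ + r.elim g fun _ => 0) + r.elim 0 R := by
        intro r
        cases r with
        | none =>
          simp only [Option.elim_none, add_zero]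
          by_cases h : meanReward (κ k) + 0.49 * ε < meanReward (κ a)
          · exact (hτ a M h).trans le_self_add
          · rw [hg, if_neg h]
            exact (meanLeaveProb_le_one κ Q _ _ _ _).trans le_add_self
        | some φ' =>
          simp only [Option.elim_some, add_zero]
          exact ih φ'
      refine (challengeExp_mono _ _ h1).trans ?_
      rw [challengeExp_add, challengeExp_add, challengeExp_const, challengeExp_defeat]
      refine add_le_add (add_le_add le_rfl ?_)
        (challengeExp_survive_le_budgetChange _ _ _ φ)
      by_cases h : meanReward (κ k) + 0.49 * ε < meanReward (κ a)
      · rw [hg, if_pos h, mul_zero]; exact zero_le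
      · rw [hg, if_neg h, mul_one]
        exact defeatProb_le_defeatBound κ hε0 hε1 hδ0 hδ1 hκ hC (not_lt.1 h) φ
    refine (lintegral_mono hpt).trans ?_
    rw [lintegral_const_add_tsum_mul Q _ hmw c, add_assoc, add_comm (defeatBound _ _ _ _)]
    exact le_rfl

/-- The probability that a king is beaten by an arm that is not much better. -/
lemma killedCost_winWeight_le (k : A) (hC : 180 ≤ C) {η : ℝ≥0∞}
    (hη : η ≤ Q {a | meanReward (κ a) ≤ meanReward (κ k)}) (M : ℕ) :
    killedCost (winWeight κ Q ε δ k) (budgetChange C ε δ) (defeatBound C ε δ) M 0 ≤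
      (2⁻¹ * η)⁻¹ * 2⁻¹ ^ 19 := by
  have hs := one_le_sampleScale hε0 hε1 hδ0 hδ1
  have hb := le_budgetStep C ε δ
  have hx : (budgetChange C ε δ 0 : ℝ) = budgetStep C ε δ - sampleSize ε δ 1 := by
    simp [budgetChange, levelSum]
  have hKC : 180 * sampleScale ε δ ≤ sampleScale ε δ * C := by nlinarith
  have hx1 : 180 * sampleScale ε δ ≤ budgetChange C ε δ 0 := by rw [hx]; linarith
  have hx0 : 0 < budgetChange C ε δ 0 := by
    have : (0 : ℝ) < budgetChange C ε δ 0 := by linarith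
    exact_mod_cast this
  refine (killedCost_zero_le _ (tsum_winWeight_le κ Q k) (budgetChange C ε δ) 0 hx0 _
    (antitone_defeatBound hε0 hε1 hδ0 hδ1) M).trans ?_
  -- Against an arm that is no better, the king wins the first trial with probability at least 1/2.
  have hw : 2⁻¹ * η ≤ winWeight κ Q ε δ k 0 := by
    have hm := measurable_meanReward κ
    have hset : MeasurableSet {a | meanReward (κ a) ≤ meanReward (κ k)} :=
      measurableSet_le hm measurable_const
    calc 2⁻¹ * η ≤ 2⁻¹ * Q {a | meanReward (κ a) ≤ meanReward (κ k)} := by gcongr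
      _ = ∫⁻ a, Set.indicator {a | meanReward (κ a) ≤ meanReward (κ k)} (fun _ => 2⁻¹) a ∂Q := by
          rw [lintegral_indicator hset, setLIntegral_const]
      _ ≤ winWeight κ Q ε δ k 0 := by
          refine lintegral_mono fun a => ?_
          rw [Set.indicator_apply]
          split_ifs with h
          · have h' : meanReward (κ a) ≤ meanReward (κ k) := h
            rw [winAt_zero]
            have h1 := (trial_false_le_of_mean_le κ hε0 hε1 hδ0 hδ1 hκ
              (show meanReward (κ a) ≤ meanReward (κ k) + 0.49 * ε by linarith) 1).trans
              (ofReal_two_mul_exp_le 1)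
            have h2 := trial_true_add_false ε (sampleSize ε δ 1) (κ k) (κ a)
            have h3 : (2⁻¹ : ℝ≥0∞) ^ (1 + 1) ≤ 2⁻¹ := by
              rw [pow_succ, pow_one]
              exact mul_le_of_le_one_right' (by simp)
            have h4 : (2⁻¹ : ℝ≥0∞) + 2⁻¹ ≤ trial ε (sampleSize ε δ 1) (κ k) (κ a) true + 2⁻¹ := by
              rw [ENNReal.inv_two_add_inv_two, ← h2]
              gcongr
              exact h1.trans h3
            exact (ENNReal.add_le_add_iff_right (by simp)).1 h4
          · exact zero_le
  have hβ : ∀ i : ℕ, defeatBound C ε δ (i * budgetChange C ε δ 0) ≤ 2⁻¹ ^ 20 * 2⁻¹ ^ i := by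
    intro i
    have h1 : (2⁻¹ : ℝ≥0∞) ^ 20 * 2⁻¹ ^ i =
        ENNReal.ofReal (Real.exp (-(Real.log 2 * (20 + i)))) := by
      rw [show -(Real.log 2 * (20 + (i : ℝ))) = (20 + i : ℕ) * -Real.log 2 by push_cast; ring,
        Real.exp_nat_mul, ← Real.log_inv, Real.exp_log (by norm_num), ← pow_add,
        ENNReal.ofReal_pow (by norm_num), ENNReal.ofReal_inv_of_pos (by norm_num)]
      simp
    rw [h1, defeatBound]
    apply ENNReal.ofReal_le_ofReal
    have h4 : Real.log 4 = 2 * Real.log 2 := by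
      rw [show (4 : ℝ) = 2 ^ 2 by norm_num, Real.log_pow]; norm_num
    have hl : 0 < Real.log 2 := Real.log_pos (by norm_num)
    -- Here 180 = 9 · 20: each window is at least 180 scales long, and the 9 in `defeatBound` leaves
    -- 20 per window.
    have h5 : (i + 1 : ℝ) * 20 ≤
        (((i * budgetChange C ε δ 0 : ℤ) : ℝ) + budgetStep C ε δ) / (9 * sampleScale ε δ) := by
      rw [le_div_iff₀ (by positivity)]
      push_cast
      have h6 : (i : ℝ) * (180 * sampleScale ε δ) ≤ i * budgetChange C ε δ 0 := by gcongr
      have h7 : (0 : ℝ) ≤ sampleSize ε δ 1 := by positivity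
      linarith
    rw [h4]
    calc _ ≤ 2 * Real.exp (-(2 * Real.log 2 * ((i + 1 : ℝ) * 20))) := by gcongr
      _ = Real.exp (Real.log 2 + -(2 * Real.log 2 * ((i + 1 : ℝ) * 20))) := by
          rw [Real.exp_add, Real.exp_log (by norm_num)]
      _ ≤ _ := by
          refine Real.exp_le_exp.2 ?_
          have : (0 : ℝ) ≤ i := by positivity
          nlinarith
  refine mul_le_mul' (ENNReal.inv_le_inv.2 hw) ((ENNReal.tsum_le_tsum hβ).trans (le_of_eq ?_))
  rw [ENNReal.tsum_mul_left, ENNReal.tsum_geometric, ENNReal.one_sub_inv_two, inv_inv,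
    pow_succ _ 19, mul_assoc, ENNReal.inv_mul_cancel two_ne_zero ENNReal.ofNat_ne_top, mul_one]

/-- A new king with a mean that is not among the lowest rarely leaves the good zone. -/
lemma meanLeaveProb_le_of_rank (hC : 180 ≤ C) {η : ℝ≥0∞} (j : ℕ) (k : A)
    (hk : θ ≤ meanReward (κ k)) (hη : η ≤ Q {a | meanReward (κ a) ≤ meanReward (κ k)})
    (hj : 1 - 0.49 * ε * j < meanReward (κ k)) (M : ℕ) :
    meanLeaveProb κ C ε δ θ Q 0 M k 0 ≤ j * ((2⁻¹ * η)⁻¹ * 2⁻¹ ^ 19) := by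
  induction j generalizing k M with
  | zero =>
    -- With no upgrade left the mean would exceed 1.
    have := meanReward_le_one κ hκ k
    norm_num at hj
    linarith
  | succ j ih =>
    have := meanLeaveProb_le_add_killedCost κ Q hε0 hε1 hδ0 hδ1 hκ k (C := C) (by linarith) hk
      (τ := j * ((2⁻¹ * η)⁻¹ * 2⁻¹ ^ 19)) (fun a M ha => by
        have h0 : meanReward (κ k) ≤ meanReward (κ a) := by linarith
        -- A better king has at least as many weaker opponents, so the rank condition is inherited.
        refine ih a (hk.trans h0) (hη.trans (measure_mono fun c hc => le_trans hc h0)) ?_ M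
        push_cast at hj
        linarith) M 0
    refine this.trans ?_
    rw [Nat.cast_succ, add_mul, one_mul]
    exact add_le_add le_rfl (killedCost_winWeight_le κ Q hε0 hε1 hδ0 hδ1 hκ k hC hη M)

/-- A bad king is eventually replaced by a good one. -/
lemma meanLeaveProb_le_of_lt {v : ℝ≥0∞}
    (hv : ∀ a M, 1 - ε ≤ meanReward (κ a) → meanLeaveProb κ C ε δ (1 - ε) Q 0 M a 0 ≤ v)
    (N M : ℕ) (k : A) (hk : meanReward (κ k) < 1 - ε) (φ : ℕ) :
    meanLeaveProb κ C ε δ (1 - ε) Q N (N + M) k φ ≤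
      v + (2⁻¹ * Q {a | 1 - 0.5 * ε ≤ meanReward (κ a)} +
        Q {a | 1 - 0.5 * ε ≤ meanReward (κ a)}ᶜ) ^ N := by
  classical
  set G := {a | 1 - 0.5 * ε ≤ meanReward (κ a)} with hG
  have hGm : MeasurableSet G := measurableSet_le measurable_const (measurable_meanReward κ)
  set ρ := 2⁻¹ * Q G + Q Gᶜ with hρ
  induction N generalizing k φ with
  | zero =>
    rw [pow_zero]
    exact (meanLeaveProb_le_one κ Q _ _ _ _).trans le_add_self
  | succ N ih =>
    rw [show N + 1 + M = N + M + 1 by ring, meanLeaveProb, if_neg (by simp), Nat.add_sub_cancel]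
    -- After one arrival either the king is good, at cost at most `v`, or it is still bad and the
    -- induction hypothesis applies. An arm in `G` leaves a bad king with probability at most 1/2;
    -- for any other arm nothing is claimed.
    have hpt : ∀ a, challengeExp ε δ (κ k) (κ a) 1 (φ + budgetStep C ε δ) (fun r =>
        r.elim (meanLeaveProb κ C ε δ (1 - ε) Q N (N + M) a 0)
          (meanLeaveProb κ C ε δ (1 - ε) Q N (N + M) k)) ≤
        v + ρ ^ N * (G.indicator (fun _ => 2⁻¹) a + Gᶜ.indicator (fun _ => 1) a) := by
      intro a
      set g : ℝ≥0∞ := if a ∈ G then 0 else 1 with hg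
      have h1 : ∀ r : Option ℕ, r.elim (meanLeaveProb κ C ε δ (1 - ε) Q N (N + M) a 0)
          (meanLeaveProb κ C ε δ (1 - ε) Q N (N + M) k) ≤
          v + ρ ^ N * (r.elim g fun _ => 1) := by
        intro r
        cases r with
        | none =>
          simp only [Option.elim_none]
          by_cases ha : meanReward (κ a) < 1 - ε
          · have : a ∉ G := fun h => by
              have h' : 1 - 0.5 * ε ≤ meanReward (κ a) := h
              linarith
            rw [hg, if_neg this, mul_one]
            exact ih a ha 0
          · exact ((meanLeaveProb_le_zero_left κ Q _ _ _ _).trans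
              (hv a _ (not_lt.1 ha))).trans le_self_add
        | some φ' =>
          simp only [Option.elim_some, mul_one]
          exact ih k hk φ'
      refine (challengeExp_mono _ _ h1).trans ?_
      rw [challengeExp_add, challengeExp_const, challengeExp_const_mul]
      gcongr
      by_cases ha : a ∈ G
      · rw [Set.indicator_of_mem ha, Set.indicator_of_notMem (by simpa using ha), add_zero]
        have ha' : 1 - 0.5 * ε ≤ meanReward (κ a) := ha
        have h2 := le_defeatProb (κ k) (κ a) (fun ℓ _ =>
          trial_true_le_of_le_mean κ hε0 hε1 hδ0 hδ1 hκ
            (show meanReward (κ k) + 0.5 * ε ≤ meanReward (κ a) by linarith) ℓ)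
          (φ + budgetStep C ε δ) 1 le_rfl
        have h3 := challengeExp_defeat (ε := ε) (δ := δ) (κ k) (κ a) 1 (φ + budgetStep C ε δ) 1
        have h4 : challengeExp ε δ (κ k) (κ a) 1 (φ + budgetStep C ε δ)
            (fun r => (r.elim g fun _ => 1) + (r.elim 1 fun _ => 0)) = 1 := by
          have h5 : (fun r : Option ℕ => (r.elim g fun _ => 1) + (r.elim 1 fun _ => 0)) =
              fun _ => (1 : ℝ≥0∞) := by
            funext r
            cases r <;> simp [hg, ha]
          rw [h5, challengeExp_const]
        rw [challengeExp_add, h3, mul_one] at h4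
        rw [pow_one] at h2
        rw [← h4] at h2
        exact (ENNReal.add_le_add_iff_right
          (ne_top_of_le_ne_top ENNReal.one_ne_top (defeatProb_le_one _ _ _ _))).1 h2
      · rw [Set.indicator_of_notMem ha, Set.indicator_of_mem (by simpa using ha), zero_add]
        refine le_of_le_of_eq (challengeExp_mono _ _ fun r => ?_)
          (challengeExp_const (ε := ε) (δ := δ) (κ k) (κ a) 1 (φ + budgetStep C ε δ) 1)
        cases r <;> simp [hg, ha]
    refine (lintegral_mono hpt).trans (le_of_eq ?_)
    have hρt : ρ ^ N ≠ ∞ := ENNReal.pow_ne_top (ENNReal.add_ne_top.2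
      ⟨ENNReal.mul_ne_top (by simp) (measure_ne_top _ _), measure_ne_top _ _⟩)
    have hm1 : Measurable (G.indicator fun _ : A => (2⁻¹ : ℝ≥0∞)) :=
      measurable_const.indicator hGm
    have hm2 : Measurable (Gᶜ.indicator fun _ : A => (1 : ℝ≥0∞)) :=
      measurable_const.indicator hGm.compl
    rw [lintegral_add_left measurable_const, lintegral_const, measure_univ, mul_one,
      lintegral_const_mul' _ _ hρt, lintegral_add_left hm1, lintegral_indicator hGm,
      lintegral_indicator hGm.compl, setLIntegral_const, setLIntegral_const, one_mul, pow_succ]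

/-- For a stream of independent arms, the king is eventually always good with high probability. -/
theorem exists_lintegral_meanLeaveProb_le (hC : 180 ≤ C)
    (hG : 0 < Q {a | 1 - 0.5 * ε ≤ meanReward (κ a)}) :
    ∃ N, ∀ M, ∫⁻ a, meanLeaveProb κ C ε δ (1 - ε) Q N (N + M) a 0 ∂Q ≤
      ENNReal.ofReal (3 / 100) := by
  classical
  have hm := measurable_meanReward κ
  -- The rank threshold is paid directly for a low-ranked first king and enters the cost of a reign
  -- inversely; 1/50 keeps both small.
  set η : ℝ≥0∞ := ENNReal.ofReal (1 / 50) with hη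
  -- Three reigns suffice because 3 · 0.49 > 1, whereas 2 · 0.49 < 1.
  set τ : ℝ≥0∞ := (3 : ℕ) * ((2⁻¹ * η)⁻¹ * 2⁻¹ ^ 19) with hτ
  have hτ' : τ ≤ ENNReal.ofReal (1 / 1000) := by
    have h2 : (2⁻¹ : ℝ≥0∞) = ENNReal.ofReal 2⁻¹ := by
      rw [ENNReal.ofReal_inv_of_pos (by norm_num)]; simp
    have h3 : ((3 : ℕ) : ℝ≥0∞) = ENNReal.ofReal 3 := by simp
    rw [hτ, hη, h2, h3, ← ENNReal.ofReal_mul (by norm_num), ← ENNReal.ofReal_inv_of_pos (by norm_num),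
      ← ENNReal.ofReal_pow (by norm_num), ← ENNReal.ofReal_mul (by norm_num),
      ← ENNReal.ofReal_mul (by norm_num)]
    apply ENNReal.ofReal_le_ofReal
    norm_num
  have hgood : ∀ k M, 1 - ε ≤ meanReward (κ k) →
      η ≤ Q {a | meanReward (κ a) ≤ meanReward (κ k)} →
      meanLeaveProb κ C ε δ (1 - ε) Q 0 M k 0 ≤ τ := fun k M hk hk' =>
    meanLeaveProb_le_of_rank κ Q hε0 hε1 hδ0 hδ1 hκ hC 3 k hk hk'
      (by push_cast; linarith) M
  by_cases hcase : η ≤ Q {a | meanReward (κ a) ≤ 1 - ε}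
  · have hv : ∀ a M, 1 - ε ≤ meanReward (κ a) →
        meanLeaveProb κ C ε δ (1 - ε) Q 0 M a 0 ≤ τ := fun a M ha =>
      hgood a M ha (hcase.trans (measure_mono fun c hc => le_trans hc ha))
    set G := {a | 1 - 0.5 * ε ≤ meanReward (κ a)} with hGdef
    have hGm : MeasurableSet G := measurableSet_le measurable_const hm
    set ρ := 2⁻¹ * Q G + Q Gᶜ with hρ
    have hρ1 : ρ < 1 := by
      have h1 : Q G + Q Gᶜ = 1 := by rw [measure_add_measure_compl hGm, measure_univ]
      rw [hρ, ← h1]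
      refine ENNReal.add_lt_add_right (measure_ne_top _ _) ?_
      calc 2⁻¹ * Q G < 1 * Q G := by
            refine ENNReal.mul_lt_mul_left hG.ne' (measure_ne_top _ _) ?_
            exact ENNReal.inv_lt_one.2 (by norm_num)
        _ = Q G := one_mul _
    have hlim := ENNReal.tendsto_pow_atTop_nhds_zero_of_lt_one hρ1
    obtain ⟨N, hN⟩ := (hlim.eventually_le_const
      (show (0 : ℝ≥0∞) < ENNReal.ofReal (1 / 1000) by simp)).exists
    refine ⟨N, fun M => ?_⟩
    have hpt : ∀ a, meanLeaveProb κ C ε δ (1 - ε) Q N (N + M) a 0 ≤ ENNReal.ofReal (3 / 100) := by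
      intro a
      have : meanLeaveProb κ C ε δ (1 - ε) Q N (N + M) a 0 ≤ τ + ρ ^ N := by
        by_cases ha : meanReward (κ a) < 1 - ε
        · exact meanLeaveProb_le_of_lt κ Q hε0 hε1 hδ0 hδ1 hκ hv N M a ha 0
        · exact ((meanLeaveProb_le_zero_left κ Q _ _ _ _).trans
            (hv a _ (not_lt.1 ha))).trans le_self_add
      refine this.trans ((add_le_add hτ' hN).trans ?_)
      rw [← ENNReal.ofReal_add (by norm_num) (by norm_num)]
      exact ENNReal.ofReal_le_ofReal (by norm_num)
    refine (lintegral_mono hpt).trans ?_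
    simp
  · refine ⟨0, fun M => ?_⟩
    push Not at hcase
    -- Bad arms are rarer than `η` here, so they all lie in the low-rank set `B`. Outside `B` the
    -- first king is good and has the required rank, and no waiting time is needed.
    set B := {a | Q {c | meanReward (κ c) ≤ meanReward (κ a)} < η} with hB
    have hmap : ∀ x, Q.map (fun a => meanReward (κ a)) (Set.Iic x) =
        Q {c | meanReward (κ c) ≤ x} := fun x => Measure.map_apply hm measurableSet_Iic
    have hD := measure_measure_Iic_lt_le (Q.map fun a => meanReward (κ a)) η
    have hBeq : B = (fun a => meanReward (κ a)) ⁻¹'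
        {x | Q.map (fun a => meanReward (κ a)) (Set.Iic x) < η} := by
      ext a
      simp [hB, hmap]
    have hlow : IsLowerSet {x | Q.map (fun a => meanReward (κ a)) (Set.Iic x) < η} :=
      fun x y hyx hx => (measure_mono (Set.Iic_subset_Iic.2 hyx)).trans_lt hx
    have hBm : MeasurableSet B := by rw [hBeq]; exact hm hlow.ordConnected.measurableSet
    have hQB : Q B ≤ η := by
      rw [hBeq, ← Measure.map_apply hm hlow.ordConnected.measurableSet]; exact hD
    have hpt : ∀ a, meanLeaveProb κ C ε δ (1 - ε) Q 0 (0 + M) a 0 ≤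
        τ + B.indicator (fun _ => 1) a := by
      intro a
      by_cases ha : a ∈ B
      · rw [Set.indicator_of_mem ha]
        exact (meanLeaveProb_le_one κ Q _ _ _ _).trans le_add_self
      · rw [Set.indicator_of_notMem ha, add_zero]
        have ha' : η ≤ Q {c | meanReward (κ c) ≤ meanReward (κ a)} := not_lt.1 ha
        refine hgood a _ ?_ ha'
        by_contra hlt
        push Not at hlt
        exact absurd (ha'.trans (measure_mono fun c hc => le_trans hc hlt.le)) (not_le.2 hcase)
    refine (lintegral_mono hpt).trans ?_
    rw [lintegral_add_left measurable_const, lintegral_const, measure_univ, mul_one,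
      lintegral_indicator hBm, setLIntegral_const, one_mul]
    refine (add_le_add hτ' hQB).trans ?_
    rw [← ENNReal.ofReal_add (by norm_num) (by norm_num)]
    exact ENNReal.ofReal_le_ofReal (by norm_num)

end Reigns

/-! ### Averages over random orders -/

section Exchange

/-- A permutation of the first `n` natural numbers, as a permutation of all of them. -/
def extPerm {n : ℕ} (σ : Equiv.Perm (Fin n)) : Equiv.Perm ℕ :=
  σ.extendDomain Fin.equivSubtype

lemma extPerm_apply {n : ℕ} (σ : Equiv.Perm (Fin n)) (i : Fin n) : extPerm σ i = σ i :=
  Equiv.Perm.extendDomain_apply_image σ Fin.equivSubtype i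

lemma extPerm_apply_of_le {n : ℕ} (σ : Equiv.Perm (Fin n)) {i : ℕ} (hi : n ≤ i) :
    extPerm σ i = i :=
  Equiv.Perm.extendDomain_apply_not_subtype σ Fin.equivSubtype (not_lt.2 hi)

lemma extPerm_mul {n : ℕ} (σ τ : Equiv.Perm (Fin n)) :
    extPerm (σ * τ) = extPerm σ * extPerm τ :=
  (Equiv.Perm.extendDomain_mul Fin.equivSubtype σ τ).symm

lemma exists_extPerm_eq {n : ℕ} {e : Equiv.Perm ℕ} (he : ∀ i, n ≤ i → e i = i) :
    ∃ σ : Equiv.Perm (Fin n), extPerm σ = e := by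
  have hlt : ∀ i, e i < n ↔ i < n := by
    intro i
    constructor
    · intro h
      by_contra hi
      rw [he i (not_lt.1 hi)] at h
      exact hi h
    · intro h
      by_contra hi
      have := e.injective (he (e i) (not_lt.1 hi))
      omega
  refine ⟨Fin.equivSubtype.symm.permCongr (e.subtypePerm hlt), ?_⟩
  ext i
  by_cases hi : i < n
  · have := extPerm_apply (Fin.equivSubtype.symm.permCongr (e.subtypePerm hlt)) ⟨i, hi⟩
    simpa using this
  · rw [extPerm_apply_of_le _ (not_lt.1 hi), he i (not_lt.1 hi)]

/-- Composition with a transposition matches the permutations sending `i` to `j'` with those sending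
it to `j`, so the `n` classes are equally large. -/
lemma card_perm_apply_eq {n : ℕ} (i j : Fin n) :
    n * (Finset.univ.filter fun σ : Equiv.Perm (Fin n) => σ i = j).card = n.factorial := by
  classical
  have hcard : ∀ j', (Finset.univ.filter fun σ : Equiv.Perm (Fin n) => σ i = j').card =
      (Finset.univ.filter fun σ : Equiv.Perm (Fin n) => σ i = j).card := by
    intro j'
    refine Finset.card_bij (fun σ _ => Equiv.swap j' j * σ) ?_ ?_ ?_
    · intro σ hσ
      simp only [Finset.mem_filter, Finset.mem_univ, true_and] at hσ ⊢
      simp [hσ]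
    · intro σ _ τ _ h
      exact mul_left_cancel h
    · intro τ hτ
      simp only [Finset.mem_filter, Finset.mem_univ, true_and] at hτ
      refine ⟨Equiv.swap j' j * τ, ?_, ?_⟩
      · simp [hτ]
      · rw [← mul_assoc, Equiv.swap_mul_self, one_mul]
  have hsum := Finset.card_eq_sum_card_fiberwise
    (f := fun σ : Equiv.Perm (Fin n) => σ i) (s := Finset.univ) (t := Finset.univ)
    (fun _ _ => Finset.mem_coe.2 (Finset.mem_univ _))
  rw [Finset.card_univ, Fintype.card_perm, Fintype.card_fin] at hsum
  rw [hsum, Finset.sum_congr rfl fun j' _ => hcard j', Finset.sum_const, Finset.card_univ,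
    Fintype.card_fin, smul_eq_mul]

/-- Few permutations map an element less than `m` to an element less than `m`. -/
lemma card_perm_meet_le {n : ℕ} (m : ℕ) :
    n * (Finset.univ.filter fun σ : Equiv.Perm (Fin n) =>
      ∃ i : Fin n, (i : ℕ) < m ∧ (σ i : ℕ) < m).card ≤ m ^ 2 * n.factorial := by
  classical
  set S : Finset (Fin n) := Finset.univ.filter fun i => (i : ℕ) < m with hS
  have hSm : S.card ≤ m := by
    calc S.card ≤ (Finset.range m).card :=
          Finset.card_le_card_of_injOn (fun i => (i : ℕ)) (fun i hi => by simpa [hS] using hi)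
            Fin.val_injective.injOn
      _ = m := Finset.card_range m
  have hsub : (Finset.univ.filter fun σ : Equiv.Perm (Fin n) =>
      ∃ i : Fin n, (i : ℕ) < m ∧ (σ i : ℕ) < m) ⊆ (S ×ˢ S).biUnion fun p =>
        Finset.univ.filter fun σ : Equiv.Perm (Fin n) => σ p.1 = p.2 := by
    intro σ hσ
    obtain ⟨i, h1, h2⟩ := (Finset.mem_filter.1 hσ).2
    simp only [Finset.mem_biUnion, Finset.mem_filter, Finset.mem_univ, true_and,
      Finset.mem_product, hS]
    exact ⟨(i, σ i), ⟨h1, h2⟩, rfl⟩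
  calc _ ≤ n * ∑ p ∈ S ×ˢ S, (Finset.univ.filter fun σ : Equiv.Perm (Fin n) =>
          σ p.1 = p.2).card :=
        Nat.mul_le_mul_left _ ((Finset.card_le_card hsub).trans Finset.card_biUnion_le)
    _ = S.card * S.card * n.factorial := by
        rw [Finset.mul_sum, Finset.sum_congr rfl fun p _ => card_perm_apply_eq p.1 p.2,
          Finset.sum_const, Finset.card_product, smul_eq_mul]
    _ ≤ m ^ 2 * n.factorial := by rw [sq]; gcongr

variable {A : Type*}

/-- The average of `f` over all orders of the first `n` terms of the sequence `ω`. -/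
def permAvg (n : ℕ) (f : (ℕ → A) → ℝ) (ω : ℕ → A) : ℝ :=
  (∑ σ : Equiv.Perm (Fin n), f (ω ∘ extPerm σ)) / n.factorial

/-- Left translation permutes the summands. All averages of index at least `n` are thus symmetric in
the first `n` terms, which is the reverse martingale structure. -/
lemma permAvg_comp_perm (n : ℕ) (f : (ℕ → A) → ℝ) (ω : ℕ → A) {e : Equiv.Perm ℕ}
    (he : ∀ i, n ≤ i → e i = i) : permAvg n f (ω ∘ e) = permAvg n f ω := by
  obtain ⟨τ, rfl⟩ := exists_extPerm_eq he
  unfold permAvg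
  congr 1
  refine Fintype.sum_equiv (Equiv.mulLeft τ) _ _ fun σ => ?_
  rw [Equiv.coe_mulLeft, extPerm_mul]
  rfl

lemma permAvg_sub (n : ℕ) (f g : (ℕ → A) → ℝ) (ω : ℕ → A) :
    permAvg n (fun ω => f ω - g ω) ω = permAvg n f ω - permAvg n g ω := by
  simp only [permAvg, Finset.sum_sub_distrib, sub_div]

lemma permAvg_const (n : ℕ) (c : ℝ) (ω : ℕ → A) : permAvg n (fun _ => c) ω = c := by
  have : (n.factorial : ℝ) ≠ 0 := by exact_mod_cast n.factorial_ne_zero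
  simp only [permAvg, Finset.sum_const, Finset.card_univ, Fintype.card_perm, Fintype.card_fin,
    nsmul_eq_mul]
  field_simp

lemma permAvg_mono (n : ℕ) {f g : (ℕ → A) → ℝ} (h : ∀ ω, f ω ≤ g ω) (ω : ℕ → A) :
    permAvg n f ω ≤ permAvg n g ω :=
  div_le_div_of_nonneg_right (Finset.sum_le_sum fun _ _ => h _) (by positivity)

lemma abs_permAvg_le (n : ℕ) (f : (ℕ → A) → ℝ) (ω : ℕ → A) :
    |permAvg n f ω| ≤ permAvg n (fun ω => |f ω|) ω := by
  unfold permAvg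
  rw [abs_div, Nat.abs_cast]
  gcongr
  exact Finset.abs_sum_le_sum_abs _ _

variable [MeasurableSpace A]

lemma measurable_comp_perm (e : Equiv.Perm ℕ) : Measurable fun ω : ℕ → A => ω ∘ e :=
  measurable_pi_lambda _ fun i => measurable_pi_apply (e i)

lemma measurable_permAvg (n : ℕ) {f : (ℕ → A) → ℝ} (hf : Measurable f) :
    Measurable (permAvg n f) :=
  (Finset.measurable_sum _ fun σ _ => hf.comp (measurable_comp_perm (extPerm σ))).div_const _

variable (Q : Measure A) [IsProbabilityMeasure Q]

lemma measurePreserving_comp_perm (e : Equiv.Perm ℕ) :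
    MeasurePreserving (fun ω : ℕ → A => ω ∘ e) (Measure.infinitePi fun _ : ℕ => Q)
      (Measure.infinitePi fun _ : ℕ => Q) :=
  ⟨measurable_comp_perm e,
    Measure.map_infinitePi_infinitePi_of_inj (P := fun _ : ℕ => Q) e.injective⟩

variable {Q}

local notation "μ∞" => Measure.infinitePi fun _ : ℕ => Q

lemma integrable_comp_perm {f : (ℕ → A) → ℝ} (hf : Integrable f μ∞) (e : Equiv.Perm ℕ) :
    Integrable (fun ω => f (ω ∘ e)) μ∞ :=
  (measurePreserving_comp_perm Q e).integrable_comp_of_integrable hf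

lemma integrable_permAvg (n : ℕ) {f : (ℕ → A) → ℝ} (hf : Integrable f μ∞) :
    Integrable (permAvg n f) μ∞ :=
  (integrable_finsetSum _ fun σ _ => integrable_comp_perm hf (extPerm σ)).div_const _

lemma integral_comp_perm {f : (ℕ → A) → ℝ} (hf : AEStronglyMeasurable f μ∞) (e : Equiv.Perm ℕ) :
    ∫ ω, f (ω ∘ e) ∂μ∞ = ∫ ω, f ω ∂μ∞ := by
  have h := measurePreserving_comp_perm Q e
  rw [← integral_map (φ := fun ω : ℕ → A => ω ∘ e) h.measurable.aemeasurable
    (by rwa [h.map_eq]), h.map_eq]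

/-- On a set that is invariant under permutations of the first `n` terms, averaging over these
permutations does not change the integral. -/
lemma setIntegral_permAvg (n : ℕ) {f : (ℕ → A) → ℝ} (hf : Integrable f μ∞) {B : Set (ℕ → A)}
    (hB : MeasurableSet B)
    (hinv : ∀ (σ : Equiv.Perm (Fin n)) (ω : ℕ → A), ω ∘ extPerm σ ∈ B ↔ ω ∈ B) :
    ∫ ω in B, permAvg n f ω ∂μ∞ = ∫ ω in B, f ω ∂μ∞ := by
  have hn : (n.factorial : ℝ) ≠ 0 := by exact_mod_cast n.factorial_ne_zero
  have h : ∀ σ : Equiv.Perm (Fin n), ∫ ω in B, f (ω ∘ extPerm σ) ∂μ∞ = ∫ ω in B, f ω ∂μ∞ := by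
    intro σ
    rw [← integral_indicator hB, ← integral_indicator hB,
      ← integral_comp_perm (hf.indicator hB).aestronglyMeasurable (extPerm σ)]
    refine integral_congr_ae (Eventually.of_forall fun ω => ?_)
    beta_reduce
    by_cases h : ω ∈ B
    · rw [Set.indicator_of_mem h, Set.indicator_of_mem ((hinv σ ω).2 h)]
    · rw [Set.indicator_of_notMem h, Set.indicator_of_notMem fun h' => h ((hinv σ ω).1 h')]
  unfold permAvg
  rw [integral_div, integral_finsetSum _ fun σ _ =>
    (integrable_comp_perm hf (extPerm σ)).integrableOn, Finset.sum_congr rfl fun σ _ => h σ,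
    Finset.sum_const, Finset.card_univ, Fintype.card_perm, Fintype.card_fin, nsmul_eq_mul]
  field_simp

lemma integral_permAvg (n : ℕ) {f : (ℕ → A) → ℝ} (hf : Integrable f μ∞) :
    ∫ ω, permAvg n f ω ∂μ∞ = ∫ ω, f ω ∂μ∞ := by
  simpa using setIntegral_permAvg n hf MeasurableSet.univ (fun _ _ => Iff.rfl)

lemma integral_abs_permAvg_le (n : ℕ) {f : (ℕ → A) → ℝ} (hf : Integrable f μ∞) :
    ∫ ω, |permAvg n f ω| ∂μ∞ ≤ ∫ ω, |f ω| ∂μ∞ := by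
  rw [← integral_permAvg n hf.abs]
  exact integral_mono (integrable_permAvg n hf).abs (integrable_permAvg n hf.abs)
    fun ω => abs_permAvg_le n f ω

/-! ### Maximal inequality and law of large numbers for order averages -/

/-- A **maximal inequality** for averages over random orders. -/
lemma maximal_permAvg {f : (ℕ → A) → ℝ} (hfm : Measurable f) (hf : Integrable f μ∞) (t : ℝ)
    (n : ℕ) :
    t * (μ∞).real {ω | ∃ j, t < permAvg (n + j) f ω} ≤ ∫ ω, |permAvg n f ω| ∂μ∞ := by
  set E : ℕ → ℕ → Set (ℕ → A) := fun n d => {ω | ∃ j < d, t < permAvg (n + j) f ω} with hE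
  have hEm : ∀ n d, MeasurableSet (E n d) := by
    intro n d
    have : E n d = ⋃ j ∈ Set.Iio d, {ω | t < permAvg (n + j) f ω} := by
      ext ω; simp [hE]
    rw [this]
    exact MeasurableSet.biUnion (Set.to_countable _) fun j _ =>
      measurableSet_lt measurable_const (measurable_permAvg _ hfm)
  have hinv : ∀ m n d, m ≤ n → ∀ (σ : Equiv.Perm (Fin m)) (ω : ℕ → A),
      ω ∘ extPerm σ ∈ E n d ↔ ω ∈ E n d := by
    intro m n d hmn σ ω
    have h : ∀ j, permAvg (n + j) f (ω ∘ extPerm σ) = permAvg (n + j) f ω := fun j =>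
      permAvg_comp_perm _ _ _ fun i hi => extPerm_apply_of_le σ (by omega)
    simp only [hE, Set.mem_ofPred_eq, h]
  have key : ∀ d n, t * (μ∞).real (E n d) ≤ ∫ ω in E n d, f ω ∂μ∞ := by
    intro d
    induction d with
    | zero => intro n; simp [hE]
    | succ d ih =>
      intro n
      -- The exceedances are sorted by the last index at which they occur. "Exceeds at `n` but not
      -- later" is symmetric in the first `n` terms, so on `D` the function may be replaced by its
      -- average, which is above `t`.
      set D : Set (ℕ → A) := {ω | t < permAvg n f ω} \ E (n + 1) d with hD
      have hDm : MeasurableSet D :=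
        (measurableSet_lt measurable_const (measurable_permAvg _ hfm)).diff (hEm _ _)
      have hdisj : Disjoint (E (n + 1) d) D := Set.disjoint_sdiff_right
      have hunion : E n (d + 1) = E (n + 1) d ∪ D := by
        rw [hD, Set.union_sdiff_self]
        ext ω
        simp only [hE, Set.mem_ofPred_eq, Set.mem_union]
        constructor
        · rintro ⟨j, hj, h⟩
          cases j with
          | zero => exact Or.inr h
          | succ j => exact Or.inl ⟨j, by omega, by rwa [show n + 1 + j = n + (j + 1) by ring]⟩
        · rintro (⟨j, hj, h⟩ | h)
          · exact ⟨j + 1, by omega, by rwa [show n + (j + 1) = n + 1 + j by ring]⟩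
          · exact ⟨0, by omega, h⟩
      have hDinv : ∀ (σ : Equiv.Perm (Fin n)) (ω : ℕ → A), ω ∘ extPerm σ ∈ D ↔ ω ∈ D := by
        intro σ ω
        have h1 := hinv n (n + 1) d (by omega) σ ω
        have h2 : permAvg n f (ω ∘ extPerm σ) = permAvg n f ω :=
          permAvg_comp_perm _ _ _ fun i hi => extPerm_apply_of_le σ hi
        simp only [hD, Set.mem_sdiff, Set.mem_ofPred_eq, h1, h2]
      have hDint : t * (μ∞).real D ≤ ∫ ω in D, f ω ∂μ∞ := by
        rw [← setIntegral_permAvg n hf hDm hDinv, mul_comm]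
        have := setIntegral_mono_on (μ := μ∞) (f := fun _ => t) (g := permAvg n f)
          (integrable_const t).integrableOn (integrable_permAvg n hf).integrableOn hDm
          (fun ω hω => le_of_lt hω.1)
        rwa [setIntegral_const, smul_eq_mul] at this
      rw [hunion, measureReal_union hdisj hDm, setIntegral_union hdisj hDm hf.integrableOn
        hf.integrableOn, mul_add]
      exact add_le_add (ih (n + 1)) hDint
  have hbound : ∀ d, t * (μ∞).real (E n d) ≤ ∫ ω, |permAvg n f ω| ∂μ∞ := by
    intro d
    refine (key d n).trans ?_
    rw [← setIntegral_permAvg n hf (hEm n d) (hinv n n d le_rfl)]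
    have hi := integrable_permAvg n hf
    calc ∫ ω in E n d, permAvg n f ω ∂μ∞ ≤ ∫ ω in E n d, |permAvg n f ω| ∂μ∞ :=
          integral_mono hi.integrableOn hi.abs.integrableOn fun ω => le_abs_self _
      _ ≤ _ := setIntegral_le_integral hi.abs (Eventually.of_forall fun ω => abs_nonneg _)
  have hmono : Monotone (E n) := fun d d' h ω ⟨j, hj, hω⟩ => ⟨j, hj.trans_le h, hω⟩
  have hU : {ω | ∃ j, t < permAvg (n + j) f ω} = ⋃ d, E n d := by
    ext ω
    simp only [hE, Set.mem_ofPred_eq, Set.mem_iUnion]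
    exact ⟨fun ⟨j, h⟩ => ⟨j + 1, j, by omega, h⟩, fun ⟨_, j, _, h⟩ => ⟨j, h⟩⟩
  have hlim : Tendsto (fun d => (μ∞).real (E n d)) atTop
      (nhds ((μ∞).real {ω | ∃ j, t < permAvg (n + j) f ω})) := by
    rw [hU]
    exact (ENNReal.tendsto_toReal (measure_ne_top _ _)).comp
      (tendsto_measure_iUnion_atTop hmono)
  exact le_of_tendsto (hlim.const_mul t) (Eventually.of_forall hbound)

/-- Functions of disjoint sets of terms of an independent sequence are uncorrelated. -/
lemma integral_mul_comp_perm_eq_zero {m : ℕ} {f : (ℕ → A) → ℝ} (hfm : Measurable f)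
    (hdep : ∀ ω ω' : ℕ → A, (∀ i < m, ω i = ω' i) → f ω = f ω') (hf0 : ∫ ω, f ω ∂μ∞ = 0)
    (e : Equiv.Perm ℕ) (he : ∀ i < m, m ≤ e i) :
    ∫ ω, f ω * f (ω ∘ e) ∂μ∞ = 0 := by
  classical
  obtain ⟨a₀⟩ : Nonempty A := by
    by_contra h
    rw [not_nonempty_iff] at h
    have := measure_univ (μ := Q)
    rw [Set.univ_eq_empty_iff.2 h, measure_empty] at this
    exact zero_ne_one this
  set S : Finset ℕ := Finset.range m
  set T : Finset ℕ := S.image e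
  have hdisj : Disjoint S T := by
    rw [Finset.disjoint_left]
    intro i hi hiT
    obtain ⟨j, hj, rfl⟩ := Finset.mem_image.1 hiT
    have := he j (Finset.mem_range.1 hj)
    have := Finset.mem_range.1 hi
    omega
  have hind : iIndepFun (fun (i : ℕ) (ω : ℕ → A) => ω i) μ∞ :=
    iIndepFun_infinitePi (X := fun _ a => a) fun _ => measurable_id
  have h1 := hind.indepFun_finset S T hdisj fun i => measurable_pi_apply i
  -- Rebuilds a sequence from the observed coordinates; the filler `a₀` is harmless because `f`
  -- reads only the first `m` terms.
  let r : (S → A) → ℕ → A := fun y i => if h : i ∈ S then y ⟨i, h⟩ else a₀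
  let r' : (T → A) → ℕ → A := fun y i => if h : e i ∈ T then y ⟨e i, h⟩ else a₀
  have hr : Measurable r := measurable_pi_lambda _ fun i => by
    by_cases h : i ∈ S
    · simpa only [r, dif_pos h] using measurable_pi_apply _
    · simpa only [r, dif_neg h] using measurable_const
  have hr' : Measurable r' := measurable_pi_lambda _ fun i => by
    by_cases h : e i ∈ T
    · simpa only [r', dif_pos h] using measurable_pi_apply _
    · simpa only [r', dif_neg h] using measurable_const
  have h2 := h1.comp (hfm.comp hr) (hfm.comp hr')
  have e1 : (f ∘ r) ∘ (fun (ω : ℕ → A) (i : S) => ω i) = f := by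
    funext ω
    refine hdep _ _ fun i hi => ?_
    exact dif_pos (Finset.mem_range.2 hi)
  have e2 : (f ∘ r') ∘ (fun (ω : ℕ → A) (i : T) => ω i) = fun ω => f (ω ∘ e) := by
    funext ω
    refine hdep _ _ fun i hi => ?_
    have : e i ∈ T := Finset.mem_image_of_mem _ (Finset.mem_range.2 hi)
    simp only [r', dif_pos this, Function.comp]
  rw [e1, e2] at h2
  rw [h2.integral_fun_mul_eq_mul_integral hfm.aestronglyMeasurable
    (hfm.comp (measurable_comp_perm e)).aestronglyMeasurable, hf0, zero_mul]

/-- Averages of a centred function of `m` terms over random orders are small in `L²`. -/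
lemma integral_permAvg_sq_le {m n : ℕ} (hn : 0 < n) {f : (ℕ → A) → ℝ} (hfm : Measurable f)
    (hf1 : ∀ ω, |f ω| ≤ 1)
    (hdep : ∀ ω ω' : ℕ → A, (∀ i < m, ω i = ω' i) → f ω = f ω') (hf0 : ∫ ω, f ω ∂μ∞ = 0)
    (hmn : m ≤ n) :
    ∫ ω, permAvg n f ω ^ 2 ∂μ∞ ≤ m ^ 2 / n := by
  classical
  have hbd : ∀ {g : (ℕ → A) → ℝ}, Measurable g → (∀ ω, |g ω| ≤ 1) → Integrable g μ∞ :=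
    fun hg h => Integrable.of_bound hg.aestronglyMeasurable 1 (Eventually.of_forall h)
  have hfi := hbd hfm hf1
  have hfac : (0 : ℝ) < n.factorial := by exact_mod_cast n.factorial_pos
  have hA1 : ∀ ω, |permAvg n f ω| ≤ 1 := fun ω =>
    (abs_permAvg_le n f ω).trans ((permAvg_mono n hf1 ω).trans_eq (permAvg_const n 1 ω))
  have hAm := measurable_permAvg n hfm
  have hmul : ∀ {g g' : (ℕ → A) → ℝ}, (∀ ω, |g ω| ≤ 1) → (∀ ω, |g' ω| ≤ 1) →
      ∀ ω, |g ω * g' ω| ≤ 1 := fun h h' ω => by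
    rw [abs_mul]; exact mul_le_one₀ (h ω) (abs_nonneg _) (h' ω)
  have hprod : Integrable (fun ω => f ω * permAvg n f ω) μ∞ :=
    hbd (hfm.mul hAm) (hmul hf1 hA1)
  -- One factor is already symmetric, so the averaging in the other can be undone; a single sum over
  -- permutations is left.
  have h1 : ∫ ω, permAvg n f ω ^ 2 ∂μ∞ = ∫ ω, f ω * permAvg n f ω ∂μ∞ := by
    rw [← integral_permAvg n hprod]
    refine integral_congr_ae (Eventually.of_forall fun ω => ?_)
    simp only [sq]
    conv_rhs => rw [permAvg]
    have : ∀ σ : Equiv.Perm (Fin n), permAvg n f (ω ∘ extPerm σ) = permAvg n f ω := fun σ =>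
      permAvg_comp_perm _ _ _ fun i hi => extPerm_apply_of_le σ hi
    simp only [this]
    rw [← Finset.sum_mul, permAvg]
    ring
  have h2 : ∀ ω, f ω * permAvg n f ω =
      (∑ σ : Equiv.Perm (Fin n), f ω * f (ω ∘ extPerm σ)) / n.factorial := by
    intro ω
    rw [permAvg, ← Finset.mul_sum, mul_div_assoc]
  have hint : ∀ σ : Equiv.Perm (Fin n), Integrable (fun ω => f ω * f (ω ∘ extPerm σ)) μ∞ :=
    fun σ => hbd (hfm.mul (hfm.comp (measurable_comp_perm _))) (hmul hf1 fun ω => hf1 _)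
  -- Permutations moving the first `m` indices away from themselves give uncorrelated factors; the
  -- others make up a fraction of at most m²/n.
  have h3 : ∀ σ : Equiv.Perm (Fin n), ∫ ω, f ω * f (ω ∘ extPerm σ) ∂μ∞ ≤
      if ∃ i : Fin n, (i : ℕ) < m ∧ (σ i : ℕ) < m then 1 else 0 := by
    intro σ
    split_ifs with h
    · calc ∫ ω, f ω * f (ω ∘ extPerm σ) ∂μ∞ ≤ ∫ _, (1 : ℝ) ∂μ∞ :=
            integral_mono (hint σ) (integrable_const _) fun ω =>
              (le_abs_self _).trans (hmul hf1 (fun ω => hf1 (ω ∘ extPerm σ)) ω)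
        _ = 1 := by simp
    · refine (integral_mul_comp_perm_eq_zero hfm hdep hf0 (extPerm σ) fun i hi => ?_).le
      by_contra hlt
      refine h ⟨⟨i, by omega⟩, hi, ?_⟩
      rw [← extPerm_apply]
      exact not_le.1 hlt
  rw [h1]
  simp only [h2]
  rw [integral_div, integral_finsetSum _ fun σ _ => hint σ, div_le_div_iff₀ hfac
    (by exact_mod_cast hn)]
  have h4 := Finset.sum_le_sum fun σ (_ : σ ∈ Finset.univ) => h3 σ
  rw [Finset.sum_boole] at h4
  have h5 : ((n * (Finset.univ.filter fun σ : Equiv.Perm (Fin n) =>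
      ∃ i : Fin n, (i : ℕ) < m ∧ (σ i : ℕ) < m).card : ℕ) : ℝ) ≤ (m ^ 2 * n.factorial : ℕ) := by
    exact_mod_cast card_perm_meet_le (n := n) m
  push_cast at h5
  have hn' : (0 : ℝ) ≤ n := by positivity
  nlinarith

/-- A one-sided **law of large numbers** for averages over random orders. -/
theorem ae_eventually_permAvg_le {f : (ℕ → A) → ℝ} (hfm : Measurable f)
    (hf1 : ∀ ω, f ω ∈ Set.Icc 0 1)
    (happrox : ∀ η : ℝ, 0 < η → ∃ (m : ℕ) (g : (ℕ → A) → ℝ), Measurable g ∧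
      (∀ ω, g ω ∈ Set.Icc 0 1) ∧ (∀ ω ω' : ℕ → A, (∀ i < m, ω i = ω' i) → g ω = g ω') ∧
      ∫ ω, |f ω - g ω| ∂μ∞ ≤ η) {t : ℝ} (ht : ∫ ω, f ω ∂μ∞ < t) :
    ∀ᵐ ω ∂μ∞, ∀ᶠ n in atTop, permAvg n f ω ≤ t := by
  have hbd : ∀ {g : (ℕ → A) → ℝ}, Measurable g → (∀ ω, |g ω| ≤ 1) → Integrable g μ∞ :=
    fun hg h => Integrable.of_bound hg.aestronglyMeasurable 1 (Eventually.of_forall h)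
  have habs : ∀ {x : ℝ}, x ∈ Set.Icc (0 : ℝ) 1 → |x| ≤ 1 := fun hx => by
    rw [abs_of_nonneg hx.1]; exact hx.2
  have hfi := hbd hfm fun ω => habs (hf1 ω)
  set a := ∫ ω, f ω ∂μ∞ with ha
  set s := t - a with hs
  have hs0 : 0 < s := sub_pos.2 ht
  set h : (ℕ → A) → ℝ := fun ω => f ω - a with hh
  have hhm : Measurable h := hfm.sub_const a
  have hhi : Integrable h μ∞ := hfi.sub (integrable_const a)
  -- The centred `f` is split into the approximation error `f - g`, the centred `g`, and the
  -- difference of the two means.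
  have hsmall : ∀ η : ℝ, 0 < η → ∃ n, ∫ ω, |permAvg n h ω| ∂μ∞ ≤ 4 * η := by
    intro η hη
    obtain ⟨m, g, hgm, hg1, hgdep, hfg⟩ := happrox η hη
    have hgi := hbd hgm fun ω => habs (hg1 ω)
    set c := ∫ ω, g ω ∂μ∞ with hc
    have hc01 : c ∈ Set.Icc (0 : ℝ) 1 := by
      refine ⟨integral_nonneg fun ω => (hg1 ω).1, ?_⟩
      calc c ≤ ∫ _, (1 : ℝ) ∂μ∞ := integral_mono hgi (integrable_const _) fun ω => (hg1 ω).2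
        _ = 1 := by simp
    set k : (ℕ → A) → ℝ := fun ω => g ω - c with hk
    have hkm : Measurable k := hgm.sub_const c
    have hk1 : ∀ ω, |k ω| ≤ 1 := fun ω => by
      rw [abs_le]
      have := hg1 ω
      constructor <;> simp only [hk] <;> linarith [this.1, this.2, hc01.1, hc01.2]
    have hk0 : ∫ ω, k ω ∂μ∞ = 0 := by
      simp only [hk]
      rw [integral_sub hgi (integrable_const _)]
      simp [hc]
    have hki := hbd hkm hk1
    have hac : |c - a| ≤ η := by
      rw [hc, ha, ← integral_sub hgi hfi]
      refine (abs_integral_le_integral_abs).trans ?_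
      simp only [abs_sub_comm (g _)]
      exact hfg
    obtain ⟨n, hn⟩ := exists_nat_gt (max (m : ℝ) ((m : ℝ) ^ 2 / η ^ 2))
    have hmn : m ≤ n := by exact_mod_cast ((le_max_left _ _).trans hn.le)
    have hn0 : (0 : ℝ) < n := lt_of_le_of_lt ((Nat.cast_nonneg m).trans (le_max_left _ _)) hn
    have hsq : ∫ ω, permAvg n k ω ^ 2 ∂μ∞ ≤ η ^ 2 := by
      refine (integral_permAvg_sq_le (by exact_mod_cast hn0) hkm hk1
        (fun ω ω' h => by simp only [hk, hgdep ω ω' h]) hk0 hmn).trans ?_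
      rw [div_le_iff₀ hn0, mul_comm, ← div_le_iff₀ (by positivity)]
      exact (le_max_right _ _).trans hn.le
    refine ⟨n, ?_⟩
    have hAk1 : ∀ ω, |permAvg n k ω| ≤ 1 := fun ω =>
      (abs_permAvg_le n k ω).trans ((permAvg_mono n hk1 ω).trans_eq (permAvg_const n 1 ω))
    have hAkm := measurable_permAvg n hkm
    have hsqi : Integrable (fun ω => permAvg n k ω ^ 2) μ∞ :=
      hbd (hAkm.pow_const 2) fun ω => by
        rw [abs_pow]; exact pow_le_one₀ (abs_nonneg _) (hAk1 ω)
    have hfgi : Integrable (fun ω => f ω - g ω) μ∞ := hfi.sub hgi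
    have hpt : ∀ ω, |permAvg n h ω| ≤
        |permAvg n (fun ω => f ω - g ω) ω| + (permAvg n k ω ^ 2 / η + η) + η := by
      intro ω
      have e1 : permAvg n h ω =
          permAvg n (fun ω => f ω - g ω) ω + permAvg n k ω + (c - a) := by
        simp only [hh, hk, permAvg_sub, permAvg_const]
        ring
      have e2 : |permAvg n k ω| ≤ permAvg n k ω ^ 2 / η + η := by
        rw [← sq_abs, div_add' _ _ _ hη.ne', le_div_iff₀ hη]
        nlinarith [sq_nonneg (|permAvg n k ω| - η), abs_nonneg (permAvg n k ω)]
      rw [e1]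
      refine (abs_add_le _ _).trans (add_le_add ((abs_add_le _ _).trans (add_le_add le_rfl e2)) hac)
    have i1 := (integrable_permAvg n hfgi).abs
    have i3 : Integrable (fun ω => permAvg n k ω ^ 2 / η) μ∞ := hsqi.div_const η
    have i2 : Integrable (fun ω => permAvg n k ω ^ 2 / η + η) μ∞ := i3.add (integrable_const η)
    have i12 : Integrable (fun ω => |permAvg n (fun ω => f ω - g ω) ω| +
      (permAvg n k ω ^ 2 / η + η)) μ∞ := i1.add i2
    calc ∫ ω, |permAvg n h ω| ∂μ∞ ≤ ∫ ω, (|permAvg n (fun ω => f ω - g ω) ω| +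
          (permAvg n k ω ^ 2 / η + η) + η) ∂μ∞ :=
          integral_mono (integrable_permAvg n hhi).abs (i12.add (integrable_const η)) hpt
      _ = ∫ ω, |permAvg n (fun ω => f ω - g ω) ω| ∂μ∞ +
          ((∫ ω, permAvg n k ω ^ 2 ∂μ∞) / η + η) + η := by
          rw [integral_add i12 (integrable_const η), integral_add i1 i2,
            integral_add i3 (integrable_const η), integral_div]
          simp
      _ ≤ η + (η ^ 2 / η + η) + η := by
          gcongr
          exact (integral_abs_permAvg_le n hfgi).trans hfg
      _ = 4 * η := by field_simp; ring
  -- A single index with small L¹ norm controls, by the maximal inequality, all later exceedances at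
  -- once.
  have hzero : (μ∞).real {ω | ∀ n, ∃ j, s < permAvg (n + j) h ω} = 0 := by
    refine le_antisymm (le_of_forall_pos_le_add fun η hη => ?_) measureReal_nonneg
    obtain ⟨n, hn⟩ := hsmall (η * s / 4) (by positivity)
    have h1 := maximal_permAvg hhm hhi s n
    have h2 : (μ∞).real {ω | ∀ n, ∃ j, s < permAvg (n + j) h ω} ≤
        (μ∞).real {ω | ∃ j, s < permAvg (n + j) h ω} :=
      measureReal_mono fun ω hω => hω n
    rw [zero_add]
    refine h2.trans (le_of_mul_le_mul_left ?_ hs0)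
    linarith
  rw [ae_iff]
  refine measure_mono_null (fun ω hω => ?_)
    ((measureReal_eq_zero_iff (measure_ne_top _ _)).1 hzero)
  simp only [Set.mem_ofPred_eq, not_eventually, not_le] at hω
  intro n
  obtain ⟨n', hn', hlt⟩ := (frequently_atTop.1 hω) n
  refine ⟨n' - n, ?_⟩
  rw [Nat.add_sub_cancel' hn']
  simp only [hh, permAvg_sub, permAvg_const, hs]
  linarith

end Exchange

/-! ### The distributions of the means charge every neighbourhood of `1` -/

lemma withDensity_Ioo_pos {f : ℝ → ℝ} (hf : Measurable f) {a b : ℝ} (hab : a < b)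
    (hpos : ∀ x ∈ Set.Ioo a b, 0 < f x) :
    0 < (volume.withDensity fun x => ENNReal.ofReal (f x)) (Set.Ioo a b) := by
  rw [withDensity_apply _ measurableSet_Ioo, setLIntegral_pos_iff hf.ennreal_ofReal]
  refine lt_of_lt_of_le (b := volume (Set.Ioo a b)) ?_ (measure_mono fun x hx => ⟨?_, hx⟩)
  · rw [Real.volume_Ioo]
    exact ENNReal.ofReal_pos.2 (sub_pos.2 hab)
  · exact (ENNReal.ofReal_pos.2 (hpos x hx)).ne'

/-- If `D` had infinite mass on (0, 1], conditioning would give the zero measure; the instance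
excludes this. -/
lemma truncate_Ici_pos {D : Measure ℝ} [IsProbabilityMeasure (truncate D)] {a : ℝ} (ha : 0 ≤ a)
    (h : 0 < D (Set.Ioo a 1)) : 0 < truncate D (Set.Ici a) := by
  have hfin : D (Set.Ioc 0 1) ≠ ∞ := by
    intro h'
    have := measure_univ (μ := truncate D)
    rw [truncate, cond_apply measurableSet_Ioc, h', ENNReal.inv_top, zero_mul] at this
    exact zero_ne_one this
  rw [truncate, cond_apply measurableSet_Ioc]
  exact ENNReal.mul_pos (ENNReal.inv_ne_zero.2 hfin)
    (h.trans_le (measure_mono fun x (hx : x ∈ Set.Ioo a 1) =>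
      (⟨⟨ha.trans_lt hx.1, hx.2.le⟩, hx.1.le⟩ : x ∈ Set.Ioc 0 1 ∩ Set.Ici a))).ne'

lemma IsMeanDistribution.measure_Ici_pos {D : Measure ℝ} [IsProbabilityMeasure D]
    (hD : IsMeanDistribution D) {a : ℝ} (ha0 : 0 ≤ a) (ha1 : a < 1) : 0 < D (Set.Ici a) := by
  have hvol : ∀ {x y : ℝ}, x < y → volume (Set.Ioo x y) ≠ 0 := fun h => by
    rw [Real.volume_Ioo]
    exact (ENNReal.ofReal_pos.2 (sub_pos.2 h)).ne'
  cases hD with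
  | uniform =>
    rw [Measure.restrict_apply measurableSet_Ici]
    exact (pos_iff_ne_zero.2 (hvol ha1)).trans_le
      (measure_mono fun x hx => ⟨hx.1.le, ha0.trans_lt hx.1, hx.2.le⟩)
  | normal m v hv =>
    exact truncate_Ici_pos ha0 (pos_iff_ne_zero.2
      fun h => hvol ha1 (gaussianReal_absolutelyContinuous' m hv h))
  | lognormal m v hv =>
    refine truncate_Ici_pos ha0 (pos_iff_ne_zero.2 fun h => ?_)
    rw [lognormalMeasure, Measure.map_apply Real.measurable_exp measurableSet_Ioo] at h
    -- The point `c` avoids taking the logarithm of `a`, which may be 0.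
    obtain ⟨c, hac, hc⟩ := exists_between ha1
    have hc0 : 0 < c := ha0.trans_lt hac
    refine hvol (Real.log_neg hc0 hc) (measure_mono_null (fun x hx => ?_)
      (gaussianReal_absolutelyContinuous' m hv h))
    exact ⟨hac.trans ((Real.log_lt_iff_lt_exp hc0).1 hx.1), Real.exp_lt_one_iff.2 hx.2⟩
  | exponential r hr =>
    exact truncate_Ici_pos ha0 (withDensity_Ioo_pos (measurable_gammaPDFReal 1 r) ha1
      fun x hx => gammaPDFReal_pos one_pos hr (ha0.trans_lt hx.1))
  | beta p q hp hq =>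
    refine (withDensity_Ioo_pos (measurable_betaPDFReal p q) ha1 fun x hx => ?_).trans_le
      (measure_mono fun x hx => hx.1.le)
    exact betaPDFReal_pos (ha0.trans_lt hx.1) hx.2 hp hq
  | gamma k r hk hr =>
    exact truncate_Ici_pos ha0 (withDensity_Ioo_pos (measurable_gammaPDFReal k r) ha1
      fun x hx => gammaPDFReal_pos hk hr (ha0.trans_lt hx.1))
  | weibull k l hk hl =>
    refine truncate_Ici_pos ha0 (withDensity_Ioo_pos ?_ ha1 fun x hx => ?_)
    · exact Measurable.ite measurableSet_Ici (by fun_prop) measurable_const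
    · have hx0 : 0 < x := ha0.trans_lt hx.1
      rw [if_pos hx0.le]
      positivity


/-! ### The probability of success -/

section Success

variable {A : Type*} [MeasurableSpace A] (κ : Kernel A ℝ) [IsMarkovKernel κ]

/-- The probability that some king between the times `N` and `M` has mean less than `θ`, when
the arms arrive in the order `ω 0, ω 1, …`. -/
def badKingProb (C ε δ θ : ℝ) (N M : ℕ) (ω : ℕ → A) : ℝ≥0∞ :=
  leaveProb κ C ε δ θ N M (fun i => ω (i + 1)) (ω 0) 0

/-- The probability that some king from the time `N` on has mean less than `θ`. -/
def lateBadKingProb (C ε δ θ : ℝ) (N : ℕ) (ω : ℕ → A) : ℝ :=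
  (⨆ M, badKingProb κ C ε δ θ N (N + M) ω).toReal

variable (C ε δ θ : ℝ) (N : ℕ)

lemma measurable_badKingProb (M : ℕ) :
    Measurable (badKingProb κ C ε δ θ N M : (ℕ → A) → ℝ≥0∞) := by
  have h : Measurable fun ω : ℕ → A => ((fun i => ω (i + 1), ω 0) : (ℕ → A) × A) :=
    (measurable_pi_lambda _ fun i => measurable_pi_apply (i + 1)).prodMk (measurable_pi_apply 0)
  exact (measurable_leaveProb κ C ε δ θ N M 0).comp h

lemma badKingProb_le_one (M : ℕ) (ω : ℕ → A) : badKingProb κ C ε δ θ N M ω ≤ 1 :=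
  leaveProb_le_one ..

lemma monotone_badKingProb (ω : ℕ → A) :
    Monotone fun M => badKingProb κ C ε δ θ N (N + M) ω :=
  monotone_nat_of_le_succ fun M => leaveProb_mono_right _ _ _ _ _ _ _ _ _ _ (by omega)

lemma iSup_badKingProb_le_one (ω : ℕ → A) : ⨆ M, badKingProb κ C ε δ θ N (N + M) ω ≤ 1 :=
  iSup_le fun _ => badKingProb_le_one ..

lemma measurable_lateBadKingProb :
    Measurable (lateBadKingProb κ C ε δ θ N : (ℕ → A) → ℝ) :=
  (Measurable.iSup fun M => measurable_badKingProb κ C ε δ θ N (N + M)).ennreal_toReal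

lemma lateBadKingProb_mem_Icc (ω : ℕ → A) :
    lateBadKingProb κ C ε δ θ N ω ∈ Set.Icc (0 : ℝ) 1 :=
  ⟨ENNReal.toReal_nonneg, ENNReal.toReal_le_of_le_ofReal zero_le_one
    (by simpa using iSup_badKingProb_le_one κ C ε δ θ N ω)⟩

lemma badKingProb_toReal_mem_Icc (M : ℕ) (ω : ℕ → A) :
    (badKingProb κ C ε δ θ N M ω).toReal ∈ Set.Icc (0 : ℝ) 1 :=
  ⟨ENNReal.toReal_nonneg, ENNReal.toReal_le_of_le_ofReal zero_le_one
    (by simpa using badKingProb_le_one κ C ε δ θ N M ω)⟩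

lemma badKingProb_congr (M : ℕ) {ω ω' : ℕ → A} (h : ∀ i < M + 1, ω i = ω' i) :
    badKingProb κ C ε δ θ N M ω = badKingProb κ C ε δ θ N M ω' := by
  rw [badKingProb, badKingProb, h 0 (by omega)]
  exact leaveProb_congr _ _ _ _ _ _ _ (fun i hi => h (i + 1) (by omega)) _ _

lemma exists_integral_abs_lateBadKingProb_sub_le (Q : Measure A) [IsProbabilityMeasure Q]
    {η : ℝ} (hη : 0 < η) :
    ∃ M, ∫ ω, |lateBadKingProb κ C ε δ θ N ω - (badKingProb κ C ε δ θ N (N + M) ω).toReal|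
      ∂(Measure.infinitePi fun _ : ℕ => Q) ≤ η := by
  have hlim : Tendsto (fun M => ∫ ω, |lateBadKingProb κ C ε δ θ N ω -
      (badKingProb κ C ε δ θ N (N + M) ω).toReal| ∂(Measure.infinitePi fun _ : ℕ => Q)) atTop
      (nhds (∫ _, (0 : ℝ) ∂(Measure.infinitePi fun _ : ℕ => Q))) := by
    refine tendsto_integral_of_dominated_convergence (fun _ => 1) (fun M => ?_)
      (integrable_const _) (fun M => Eventually.of_forall fun ω => ?_)
      (Eventually.of_forall fun ω => ?_)
    · exact ((measurable_lateBadKingProb κ C ε δ θ N).sub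
        (measurable_badKingProb κ C ε δ θ N (N + M)).ennreal_toReal).abs.aestronglyMeasurable
    · have h1 := lateBadKingProb_mem_Icc κ C ε δ θ N ω
      have h2 := badKingProb_toReal_mem_Icc κ C ε δ θ N (N + M) ω
      rw [Real.norm_eq_abs, abs_abs, abs_le]
      constructor <;> linarith [h1.1, h1.2, h2.1, h2.2]
    · have h1 : Tendsto (fun M => (badKingProb κ C ε δ θ N (N + M) ω).toReal) atTop
          (nhds (lateBadKingProb κ C ε δ θ N ω)) :=
        (ENNReal.tendsto_toReal ((iSup_badKingProb_le_one κ C ε δ θ N ω).trans_lt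
          ENNReal.one_lt_top).ne).comp (tendsto_atTop_iSup (monotone_badKingProb κ C ε δ θ N ω))
      simpa using (h1.const_sub (lateBadKingProb κ C ε δ θ N ω)).abs
  rw [integral_zero] at hlim
  exact (hlim.eventually_le_const hη).exists

lemma integral_lateBadKingProb_le (Q : Measure A) [IsProbabilityMeasure Q] {c : ℝ} (hc : 0 ≤ c)
    (h : ∀ M, ∫⁻ a, meanLeaveProb κ C ε δ θ Q N (N + M) a 0 ∂Q ≤ ENNReal.ofReal c) :
    ∫ ω, lateBadKingProb κ C ε δ θ N ω ∂(Measure.infinitePi fun _ : ℕ => Q) ≤ c := by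
  have hm := fun M => measurable_badKingProb κ C ε δ θ N (N + M)
  unfold lateBadKingProb
  rw [integral_toReal (Measurable.iSup hm).aemeasurable
    (Eventually.of_forall fun ω => (iSup_badKingProb_le_one κ C ε δ θ N ω).trans_lt
      ENNReal.one_lt_top)]
  refine ENNReal.toReal_le_of_le_ofReal hc ?_
  rw [lintegral_iSup hm fun M M' hM ω => monotone_badKingProb κ C ε δ θ N ω hM]
  refine iSup_le fun M => ?_
  unfold badKingProb
  rw [lintegral_infinitePi_cons Q (fun a ω => leaveProb κ C ε δ θ N (N + M) ω a 0)
    ((measurable_leaveProb κ C ε δ θ N (N + M) 0).comp measurable_swap)]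
  simp only [lintegral_leaveProb]
  exact h M

open Classical in
/-- The probability that the algorithm fails on a given order of the arms. -/
lemma algorithm_failure_le (hκ : ∀ a, κ a (Set.Icc 0 1) = 1) {m : ℕ} (arm : ℕ → A)
    (σ : Equiv.Perm (Fin (m + 1))) :
    ∑' o, algorithm C ε δ (fun i : Fin (m + 1) => κ (arm i)) (List.ofFn σ) o *
      (if ∃ i, o = some i ∧ IsEpsBest (fun i : Fin (m + 1) => κ (arm i)) ε i then 0 else 1) ≤
        badKingProb κ C ε δ (1 - ε) N m (arm ∘ extPerm σ) := by
  rw [List.ofFn_succ, algorithm, ← PMF.bind_pure_comp, tsum_bind_mul]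
  simp only [Function.comp_apply, tsum_pure_mul]
  have h := processStream_le_leaveProb κ C ε δ (1 - ε) (fun i : Fin (m + 1) => arm i)
    (List.ofFn fun i : Fin m => σ i.succ) N (fun i => (arm ∘ extPerm σ) (i + 1))
    (fun i hi => by
      have hi' : i < m := by simpa using hi
      simpa using congrArg arm (extPerm_apply σ ⟨i + 1, by omega⟩)) (σ 0) 0
  have h0 : (arm ∘ extPerm σ) 0 = arm (σ 0) := congrArg arm (extPerm_apply σ 0)
  rw [List.length_ofFn] at h
  rw [badKingProb, h0]
  refine (ENNReal.tsum_le_tsum fun st => mul_le_mul_right ?_ _).trans h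
  split_ifs with h1 h2 h2
  · simp
  · simp
  · exact le_rfl
  · refine absurd ⟨st.1, rfl, ?_⟩ h1
    -- The actual maximum is replaced by 1, so mean at least 1 - ε is enough.
    have : ⨆ j : Fin (m + 1), meanReward (κ (arm j)) ≤ 1 :=
      ciSup_le fun j => meanReward_le_one κ hκ _
    rw [IsEpsBest]
    linarith [not_lt.1 h2]

/-- The probability of failure is at most the average over the orders of arrival of the
probability of a late bad king. -/
lemma one_sub_successProb_le (hκ : ∀ a, κ a (Set.Icc 0 1) = 1) {n : ℕ} (hn : N < n)
    (arm : ℕ → A) :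
    1 - successProb C ε δ (fun i : Fin n => κ (arm i)) ≤
      permAvg n (lateBadKingProb κ C ε δ (1 - ε) N) arm := by
  classical
  obtain ⟨m, rfl⟩ : ∃ m, n = m + 1 := ⟨n - 1, by omega⟩
  set law : Fin (m + 1) → Measure ℝ := fun i => κ (arm i)
  set p := algorithmRandomOrder C ε δ law with hp
  set c : Option (Fin (m + 1)) → ℝ≥0∞ := fun o =>
    if ∃ i, o = some i ∧ IsEpsBest law ε i then 0 else 1 with hc
  have hsum : p.toOuterMeasure {o | ∃ i, o = some i ∧ IsEpsBest law ε i} + ∑' o, p o * c o =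
      1 := by
    rw [PMF.toOuterMeasure_apply, ← ENNReal.tsum_add, ← PMF.tsum_coe p]
    refine tsum_congr fun o => ?_
    by_cases h : ∃ i, o = some i ∧ IsEpsBest law ε i
    · rw [Set.indicator_of_mem (by exact h)]
      simp [hc, h]
    · rw [Set.indicator_of_notMem (by exact h)]
      simp [hc, h]
  have hfail : ∑' o, p o * c o ≤
      ENNReal.ofReal (permAvg (m + 1) (lateBadKingProb κ C ε δ (1 - ε) N) arm) := by
    rw [hp, algorithmRandomOrder, tsum_bind_mul, tsum_fintype, permAvg,
      ENNReal.ofReal_div_of_pos (by positivity), div_eq_mul_inv,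
      ENNReal.ofReal_sum_of_nonneg fun σ _ => (lateBadKingProb_mem_Icc ..).1, Finset.sum_mul]
    refine Finset.sum_le_sum fun σ _ => ?_
    rw [PMF.uniformOfFintype_apply, Fintype.card_perm, Fintype.card_fin, ENNReal.ofReal_natCast,
      mul_comm]
    refine mul_le_mul_left ?_ _
    refine (algorithm_failure_le κ C ε δ N hκ arm σ).trans ?_
    rw [lateBadKingProb, ENNReal.ofReal_toReal
      ((iSup_badKingProb_le_one κ C ε δ (1 - ε) N _).trans_lt ENNReal.one_lt_top).ne]
    -- The first arm is king at time 0, so the final king reigns at time `m`, which is at least `N`.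
    -- Times beyond the stream only enlarge the supremum.
    obtain ⟨M, rfl⟩ := Nat.exists_eq_add_of_le (Nat.lt_succ_iff.1 hn)
    exact le_iSup (fun M => badKingProb κ C ε δ (1 - ε) N (N + M) (arm ∘ extPerm σ)) M
  have hA : 0 ≤ permAvg (m + 1) (lateBadKingProb κ C ε δ (1 - ε) N) arm :=
    div_nonneg (Finset.sum_nonneg fun σ _ => (lateBadKingProb_mem_Icc ..).1) (by positivity)
  have hfin : ∀ {x y : ℝ≥0∞}, x + y = 1 → x ≠ ∞ ∧ y ≠ ∞ := fun h =>
    ENNReal.add_ne_top.1 (h ▸ ENNReal.one_ne_top)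
  have h1 := congrArg ENNReal.toReal hsum
  rw [ENNReal.toReal_add (hfin hsum).1 (hfin hsum).2, ENNReal.toReal_one] at h1
  have h2 := ENNReal.toReal_le_of_le_ofReal hA hfail
  rw [successProb]
  linarith

end Success

end StreamingBandit

end

/-! ### The main theorem -/

theorem mainTheorem4 :
    ∃ C₀ : ℝ, ∀ C : ℝ, C₀ ≤ C →
      ∀ (D : Measure ℝ), StreamingBandit.IsMeanDistribution D →
      ∀ (ε δ : ℝ), 0 < ε → ε ≤ 1 / 10 → 0 < δ → δ < 1 →
      ∀ (A : Type*) [MeasurableSpace A] (Q : Measure A) [IsProbabilityMeasure Q]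
        (κ : Kernel A ℝ) [IsMarkovKernel κ],
        (∀ a, κ a (Set.Icc 0 1) = 1) →
        Q.map (fun a => StreamingBandit.meanReward (κ a)) = D →
        (∀ᵐ arm ∂(Measure.infinitePi fun _ : ℕ => Q), ∀ᶠ n : ℕ in atTop,
          0.9 * (1 - δ) ≤
            StreamingBandit.successProb C ε δ (fun i : Fin n => κ (arm i))) ∧
        (∀ᶠ n : ℕ in atTop,
          0.9 * (1 - δ) ≤
            ∫ arm, StreamingBandit.successProb C ε δ (fun i : Fin n => κ (arm i))
              ∂(Measure.infinitePi fun _ : ℕ => Q)) := by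
  refine ⟨180, fun C hC D hD ε δ hε0 hε1 hδ0 hδ1 A _ Q _ κ _ hκ hQ => ?_⟩
  have hmean := StreamingBandit.measurable_meanReward κ
  have hG : 0 < Q {a | 1 - 0.5 * ε ≤ StreamingBandit.meanReward (κ a)} := by
    have : IsProbabilityMeasure D := hQ ▸ Measure.isProbabilityMeasure_map hmean.aemeasurable
    have h := hD.measure_Ici_pos (a := 1 - 0.5 * ε) (by linarith) (by linarith)
    rwa [← hQ, Measure.map_apply hmean measurableSet_Ici] at h
  obtain ⟨N, hN⟩ :=
    StreamingBandit.exists_lintegral_meanLeaveProb_le κ Q hε0 hε1 hδ0 hδ1 hκ hC hG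
  set f : (ℕ → A) → ℝ := StreamingBandit.lateBadKingProb κ C ε δ (1 - ε) N with hf
  have hfm : Measurable f := StreamingBandit.measurable_lateBadKingProb κ C ε δ (1 - ε) N
  have hf1 : ∀ ω, f ω ∈ Set.Icc (0 : ℝ) 1 :=
    StreamingBandit.lateBadKingProb_mem_Icc κ C ε δ (1 - ε) N
  have hint : ∫ ω, f ω ∂(Measure.infinitePi fun _ : ℕ => Q) ≤ 3 / 100 :=
    StreamingBandit.integral_lateBadKingProb_le κ C ε δ (1 - ε) N Q (by norm_num) hN
  have hsucc : ∀ n, N < n → ∀ arm : ℕ → A, 1 - StreamingBandit.permAvg n f arm ≤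
      StreamingBandit.successProb C ε δ (fun i : Fin n => κ (arm i)) := fun n hn arm => by
    linarith [StreamingBandit.one_sub_successProb_le κ C ε δ N hκ hn arm]
  constructor
  · have hev := StreamingBandit.ae_eventually_permAvg_le (Q := Q) hfm hf1 (fun η hη => by
      obtain ⟨M, hM⟩ := StreamingBandit.exists_integral_abs_lateBadKingProb_sub_le
        κ C ε δ (1 - ε) N Q hη
      exact ⟨N + M + 1, _,
        (StreamingBandit.measurable_badKingProb κ C ε δ (1 - ε) N (N + M)).ennreal_toReal,
        StreamingBandit.badKingProb_toReal_mem_Icc κ C ε δ (1 - ε) N (N + M),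
        fun ω ω' h => congrArg ENNReal.toReal
          (StreamingBandit.badKingProb_congr κ C ε δ (1 - ε) N (N + M) h), hM⟩)
      -- The mean 3/100 lies strictly below 1/10, which leaves the room that almost sure convergence
      -- needs.
      (t := 1 / 10) (by linarith)
    filter_upwards [hev] with arm harm
    filter_upwards [harm, eventually_gt_atTop N] with n hn hNn
    linarith [hsucc n hNn arm]
  · filter_upwards [eventually_gt_atTop N] with n hn
    have hfi : Integrable f (Measure.infinitePi fun _ : ℕ => Q) :=
      Integrable.of_mem_Icc 0 1 hfm.aemeasurable (Eventually.of_forall hf1)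
    have hpi := StreamingBandit.integrable_permAvg n hfi
    have h1 : ∀ arm : ℕ → A,
        StreamingBandit.successProb C ε δ (fun i : Fin n => κ (arm i)) ∈ Set.Icc (0 : ℝ) 1 :=
      fun arm => ⟨ENNReal.toReal_nonneg, ENNReal.toReal_le_of_le_ofReal zero_le_one
        (by
          rw [ENNReal.ofReal_one, ← (PMF.toOuterMeasure_apply_eq_one_iff _ Set.univ).2
            (Set.subset_univ _)]
          exact measure_mono (Set.subset_univ _))⟩
    have h2 := integral_mono ((integrable_const (1 : ℝ)).sub hpi)
      (Integrable.of_mem_Icc 0 1 (StreamingBandit.measurable_successProb κ C ε δ n).aemeasurable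
        (Eventually.of_forall h1)) (hsucc n hn)
    have h3 : ∫ arm, (1 - StreamingBandit.permAvg n f arm)
        ∂(Measure.infinitePi fun _ : ℕ => Q) = 1 - ∫ ω, f ω ∂(Measure.infinitePi fun _ => Q) := by
      rw [integral_sub (integrable_const _) hpi, StreamingBandit.integral_permAvg n hfi]
      simp
    refine le_trans ?_ h2
    change _ ≤ ∫ arm, (1 - StreamingBandit.permAvg n f arm) ∂_
    rw [h3]
    linarith
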